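/- **Games.** An extensive-form game (EFG) $\mathcal G$ with players $1,\dots,n$ is a finite rooted tree whose non-leaf nodes are chance nodes (each with a probability distribution over its children) or decision nodes; the decision nodes are partitioned into information sets, each belonging to one player and having one finite set of available decisions that labels, bijectively, the outgoing edges of each of its nodes; every leaf carries a payoff vector in $\mathbb R^n$. A strategy profile $\sigma\in\Sigma$ assigns to each information set a probability distribution over its decisions; $\mathcal U^i_{\mathcal G}(\sigma)$ is the expected payoff of player $i$. A multi-agent influence model (MAIM) $\mathcal M$ is a directed acyclic graph of chance nodes, decision nodes (each owned by a player) and utility nodes (each owned by a player and without children), with a finite non-empty domain for each chance and decision node, a conditional probability distribution (CPD) given its parents for each chance node, and a real function of the values of its parents for each utility node. A decision context of a decision node is an instantiation of its parents; a policy profile $\pi\in\Pi$ assigns to each decision node and decision context a probability distribution over the domain of the node; $\mathcal U^i_{\mathcal M}(\pi)$ is the sum of the expected values of the utility nodes of player $i$ under the induced joint distribution. **Trembling hand perfection.** A perturbation vector $\delta$ assigns a positive number (in a MAIM: a number in $(0,1)$) to each decision at each information set (in a MAIM: in each decision context), with sum at most $1$ for each information set (decision context). In the game perturbed by $\delta$,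 each decision must be played with at least the prescribed probability; a Nash equilibrium of it is an admissible profile from which no player gains by a unilateral admissible deviation. A profile is a trembling hand perfect equilibrium (THPE) if there are perturbation vectors $\delta_k$ with $|\delta_k|_\infty\to0$ and Nash equilibria of the games perturbed by $\delta_k$ that converge to the profile. **Natural mappings.** A decision context is null if it has probability $0$ under every policy profile or if changing what is decided in it never changes any player's expected utility. A natural mapping between $\mathcal G$ and $\mathcal M$ is a bijection $f:\Sigma\to\Pi/{\sim}$, for an equivalence relation $\sim$ on $\Pi$ such that equivalent policy profiles differ only in null decision contexts, with $\mathcal U^i_{\mathcal G}(\sigma)=\mathcal U^i_{\mathcal M}(\pi)$ for all $\sigma$, all $\pi\in f(\sigma)$ and all players $i$. **From MAIMs to EFGs.** $\mathsf{maim2efg}(\mathcal M)$ is the set of EFGs obtained as follows. Choose a set $S$ of chance and decision nodes that contains all decision nodes and all their parents (for instance all chance and decision nodes, or only the decision nodes and their parents), and an order of $S$ in which every node precedes its descendants in $\mathcal M$. The tree splits on the nodes of $S$ in this order, so that a tree node is an instantiation $\mu$ of an initial segment of $S$. At a chance node the children have the conditional probabilities given $\mu$, computed from the CPDs of $\mathcal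 M$, and children of probability $0$ are removed. Two tree nodes at which the same decision node $D$ is decided are in the same information set (of the owner of $D$, with decisions the domain of $D$) if and only if they give the same values to the parents of $D$. The payoff of player $i$ at a leaf is the sum of the (conditional expected) values of the utility nodes of $i$ given the instantiation at the leaf. **From EFGs to MAIMs.** Let the chance nodes and the information sets of $\mathcal G$ be partitioned into intervention sets: sets of chance nodes, or sets of information sets of one player, whose members have the same number of outgoing edges per node, labelled by a common set of values; each is regarded as one variable. Write $\rho_v$ for the sequence of (variable, value) pairs along the path from the root to $v$; for an information set $I$ let $\kappa(I)$ be the set of pairs that occur in $\rho_v$ for all $v\in I$, and $\mu(I)$ the set of variables occurring in $\kappa(I)$. It is required that no path passes through an intervention set twice (in particular there is no absentmindedness), and that for distinct information sets $I,I'$ in the same intervention set $\mu(I)=\mu(I')$ and $\kappa(I)\neq\kappa(I')$. The MAIM $\mathsf{efg2maim}(\mathcal G)$ has the intervention sets as chance and decision nodes. The parents of a chance variable are the variables of all strict ancestors of its members; the parents of a decision variable are the variables in $\mu(I)$ for its information sets $I$; it is required that the resulting graph is acyclic (all these requirements hold for one-element intervention sets if there is no absentmindedness). The domain of a variable is its set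 of values, for chance variables with an additional null value $\perp$. Given an instantiation of its parents, a chance variable takes each value $x$ with the probability of the edge labelled $x$ at its member $v$ whose $\rho_v$ agrees with the instantiation, and the value $\perp$ if there is no such member. For each player $i$ and each set $A$ of variables that is the set of variables of the strict ancestors of some leaf, there is a utility node of $i$ with parent set $A$; its value is the payoff of $i$ at the leaf $L$ with ancestor variables $A$ whose $\rho_L$ agrees with the instantiation of $A$, and $0$ if there is no such leaf. **Proposition.** If $\mathcal G\in\mathsf{maim2efg}(\mathcal M)$, or $\mathcal M=\mathsf{efg2maim}(\mathcal G)$ for some choice of intervention sets, then there is a natural mapping $f$ between $\mathcal G$ and $\mathcal M$ such that for every strategy profile $\sigma$ of $\mathcal G$: $\sigma$ is a THPE of $\mathcal G$ if and only if every $\pi\in f(\sigma)$ is a THPE of $\mathcal M$. -/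

import Mathlib

open Filter Topology Relation

noncomputable section

open scoped Classical

/-! ### Extensive-form games -/

/-- The three sorts of nodes of a game tree: leaves, chance nodes, and decision nodes; a decision
node carries the information set it belongs to. -/
inductive NodeKind (Info : Type) : Type
  | leaf : NodeKind Info
  | chance : NodeKind Info
  | decision (I : Info) : NodeKind Info

/-- A finite `n`-player extensive-form game. `E` is the edge relation of a rooted tree. The
information sets are the fibres of `kind` over the labels `I : Info`; as every information set has
one player and one set of available decisions, `player` and `Act` are functions of `Info`. -/
structure EFG (n : ℕ) where
  /-- nodes of the tree -/
  V : Type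
  [fintypeV : Fintype V]
  /-- edges, from parent to child -/
  E : V → V → Prop
  root : V
  no_parent_root : ∀ u, ¬ E u root
  parent_unique : ∀ u u' v, E u v → E u' v → u = u'
  reachable : ∀ v, ReflTransGen E root v
  /-- information sets -/
  Info : Type
  [fintypeInfo : Fintype Info]
  player : Info → Fin n
  kind : V → NodeKind Info
  leaf_iff : ∀ v, kind v = .leaf ↔ ∀ w, ¬ E v w
  info_nonempty : ∀ I, ∃ v, kind v = .decision I
  /-- the distribution of nature over the children of a chance node -/
  P : ∀ {u : V}, kind u = .chance → stdSimplex ℝ {w // E u w}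
  /-- decisions available at an information set -/
  Act : Info → Type
  [fintypeAct : ∀ I, Fintype (Act I)]
  /-- the labelling of the outgoing edges of a decision node by the available decisions -/
  label : ∀ {u : V} {I : Info}, kind u = .decision I → {w // E u w} ≃ Act I
  /-- payoffs at the leaves -/
  U : {v // kind v = .leaf} → Fin n → ℝ

attribute [instance] EFG.fintypeV EFG.fintypeInfo EFG.fintypeAct

namespace EFG

variable {n : ℕ} (G : EFG n)

/-- Behavioural strategy profiles. -/
abbrev Strategy : Type := ∀ I : G.Info, stdSimplex ℝ (G.Act I)

/-- The probability that play, having reached `u`, proceeds to the child `w`. -/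
def stepProb (σ : G.Strategy) (u : G.V) (w : {w // G.E u w}) : ℝ :=
  match h : G.kind u with
  | .leaf => 0
  | .chance => (G.P h).1 w
  | .decision I => (σ I).1 (G.label h w)

/-- The probability of the path from the root to `v`: the product over the edges of this path. -/
def pathProb (σ : G.Strategy) (v : G.V) : ℝ :=
  ∏ e : {e : G.V × G.V // G.E e.1 e.2 ∧ ReflTransGen G.E e.2 v},
    G.stepProb σ e.1.1 ⟨e.1.2, e.2.1⟩

/-- Expected utility of player `i`; a maximal path is given by its leaf. -/
def expectedUtility (i : Fin n) (σ : G.Strategy) : ℝ :=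
  ∑ L : {v // G.kind v = .leaf}, G.pathProb σ L.1 * G.U L i

/-- Vectors with one entry for every decision at every information set. -/
abbrev PerturbationVector : Type := ∀ I : G.Info, G.Act I → ℝ

def IsPerturbation (δ : G.PerturbationVector) : Prop :=
  (∀ I d, 0 < δ I d) ∧ ∀ I, ∑ d, δ I d ≤ 1

/-- Strategy profiles of the perturbed game: every decision is played with at least the
prescribed probability. -/
def Perturbed (δ : G.PerturbationVector) : Set G.Strategy :=
  {σ | ∀ I d, δ I d ≤ (σ I).1 d}

/-- Nash equilibria of the perturbed game. -/
def IsPerturbedNE (δ : G.PerturbationVector) (σ : G.Strategy) : Prop :=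
  σ ∈ G.Perturbed δ ∧
    ∀ i, ∀ τ ∈ G.Perturbed δ, (∀ I, G.player I ≠ i → τ I = σ I) →
      G.expectedUtility i τ ≤ G.expectedUtility i σ

/-- Trembling hand perfect equilibria; `‖·‖` is the sup norm. -/
def IsTHPE (σ : G.Strategy) : Prop :=
  ∃ δ : ℕ → G.PerturbationVector, (∀ k, G.IsPerturbation (δ k)) ∧
    Tendsto (fun k => ‖δ k‖) atTop (𝓝 0) ∧
    ∃ s : ℕ → G.Strategy, (∀ k, G.IsPerturbedNE (δ k) (s k)) ∧ Tendsto s atTop (𝓝 σ)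

end EFG

/-! ### Multi-agent influence models -/

/-- An `n`-player multi-agent influence model with chance nodes `X`, decision nodes `D` and
utility nodes `U`. Utility nodes have no children, so all parents lie in `X ⊕ D`; the value of a
utility node is a deterministic real function of the values of its parents. -/
structure MAIM (n : ℕ) where
  X : Type
  D : Type
  U : Type
  [fintypeX : Fintype X]
  [fintypeD : Fintype D]
  [fintypeU : Fintype U]
  owner : D → Fin n
  ownerU : U → Fin n
  /-- edges between chance and decision nodes, from parent to child -/
  E : X ⊕ D → X ⊕ D → Prop
  /-- edges into utility nodes -/
  EU : X ⊕ D → U → Prop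
  acyclic : ∀ v, ¬ TransGen E v v
  dom : X ⊕ D → Type
  [fintypeDom : ∀ v, Fintype (dom v)]
  [nonemptyDom : ∀ v, Nonempty (dom v)]
  cpd : ∀ x : X, (∀ y : {y // E y (.inl x)}, dom y.1) → stdSimplex ℝ (dom (.inl x))
  util : ∀ j : U, (∀ y : {y // EU y j}, dom y.1) → ℝ

attribute [instance] MAIM.fintypeX MAIM.fintypeD MAIM.fintypeU MAIM.fintypeDom MAIM.nonemptyDom

namespace MAIM

variable {n : ℕ} (M : MAIM n)

/-- Chance and decision nodes. -/
abbrev Node : Type := M.X ⊕ M.D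

/-- Instantiations of the parents of a node. For a decision node: its decision contexts. -/
abbrev Context (v : M.Node) : Type := ∀ y : {y // M.E y v}, M.dom y.1

/-- Instantiations of all chance and decision nodes. -/
abbrev Assignment : Type := ∀ v : M.Node, M.dom v

/-- The instantiation of the parents of `v` in `a`. -/
def parents (a : M.Assignment) (v : M.Node) : M.Context v := fun y => a y.1

/-- Policy profiles: a decision rule for every decision node. -/
abbrev Policy : Type := ∀ d : M.D, M.Context (.inr d) → stdSimplex ℝ (M.dom (.inr d))

/-- The product of the CPDs of the chance nodes. -/
def weight (a : M.Assignment) : ℝ :=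
  ∏ x : M.X, (M.cpd x (M.parents a (.inl x))).1 (a (.inl x))

/-- The joint distribution induced by a policy profile. -/
def prob (π : M.Policy) (a : M.Assignment) : ℝ :=
  M.weight a * ∏ d : M.D, (π d (M.parents a (.inr d))).1 (a (.inr d))

/-- The value of the utility node `j` in `a`. -/
def utilVal (j : M.U) (a : M.Assignment) : ℝ := M.util j (fun y => a y.1)

/-- The domain of a utility node. -/
def utilDom (j : M.U) : Finset ℝ := Finset.univ.image (M.util j)

/-- The probability that the utility node `j` takes the value `u`. -/
def utilProb (π : M.Policy) (j : M.U) (u : ℝ) : ℝ :=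
  ∑ a : M.Assignment with M.utilVal j a = u, M.prob π a

/-- Expected utility of player `i`. -/
def expectedUtility (i : Fin n) (π : M.Policy) : ℝ :=
  ∑ j : M.U with M.ownerU j = i, ∑ u ∈ M.utilDom j, u * M.utilProb π j u

/-- Vectors with one entry for every decision in every decision context. -/
abbrev PerturbationVector : Type := ∀ d : M.D, M.Context (.inr d) → M.dom (.inr d) → ℝ

def IsPerturbation (δ : M.PerturbationVector) : Prop :=
  (∀ d c v, 0 < δ d c v ∧ δ d c v < 1) ∧ ∀ d c, ∑ v, δ d c v ≤ 1

/-- Policy profiles of the perturbed model. -/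
def Perturbed (δ : M.PerturbationVector) : Set M.Policy :=
  {π | ∀ d c v, δ d c v ≤ (π d c).1 v}

/-- Nash equilibria of the perturbed model. -/
def IsPerturbedNE (δ : M.PerturbationVector) (π : M.Policy) : Prop :=
  π ∈ M.Perturbed δ ∧
    ∀ i, ∀ τ ∈ M.Perturbed δ, (∀ d, M.owner d ≠ i → τ d = π d) →
      M.expectedUtility i τ ≤ M.expectedUtility i π

/-- Trembling hand perfect equilibria; `‖·‖` is the sup norm. -/
def IsTHPE (π : M.Policy) : Prop :=
  ∃ δ : ℕ → M.PerturbationVector, (∀ k, M.IsPerturbation (δ k)) ∧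
    Tendsto (fun k => ‖δ k‖) atTop (𝓝 0) ∧
    ∃ p : ℕ → M.Policy, (∀ k, M.IsPerturbedNE (δ k) (p k)) ∧ Tendsto p atTop (𝓝 π)

/-- A decision context is feasible if some policy profile gives it positive probability. -/
def Feasible (d : M.D) (c : M.Context (.inr d)) : Prop :=
  ∃ π : M.Policy, 0 < ∑ a : M.Assignment with M.parents a (.inr d) = c, M.prob π a

/-- A decision context is null if it is infeasible or if what is decided in it never has an effect
on any player's expected utility. -/
def NullContext (d : M.D) (c : M.Context (.inr d)) : Prop :=
  ¬ M.Feasible d c ∨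
    ∀ π π' : M.Policy,
      (∀ d' c', (⟨d', c'⟩ : Σ e : M.D, M.Context (.inr e)) ≠ ⟨d, c⟩ → π d' c' = π' d' c') →
        ∀ i, M.expectedUtility i π = M.expectedUtility i π'

end MAIM

/-! ### Natural mappings -/

/-- A natural mapping between a game and a model: a bijection from strategy profiles onto the
classes of an equivalence relation of policy profiles. -/
structure NaturalMapping {n : ℕ} (G : EFG n) (M : MAIM n) where
  rel : Setoid M.Policy
  map : G.Strategy ≃ Quotient rel
  null_of_rel : ∀ π π', rel.r π π' → ∀ d c, π d c ≠ π' d c → M.NullContext d c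
  utility_eq : ∀ σ π, Quotient.mk rel π = map σ →
    ∀ i, G.expectedUtility i σ = M.expectedUtility i π

/-- `f σ` as a set of policy profiles. -/
def NaturalMapping.image {n : ℕ} {G : EFG n} {M : MAIM n} (f : NaturalMapping G M)
    (σ : G.Strategy) : Set M.Policy :=
  {π | Quotient.mk f.rel π = f.map σ}

/-! ### From models to games -/

namespace MAIM

variable {n : ℕ} (M : MAIM n)

/-- A set of splitting nodes that contains all decision nodes and all their parents, with an
enumeration in which every node comes before its descendants. The two extreme choices of `S` are
all chance and decision nodes, and the decision nodes with their parents. -/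
structure Splitting where
  S : Finset M.Node
  dec_mem : ∀ d : M.D, Sum.inr d ∈ S
  parent_mem : ∀ (d : M.D) (y : M.Node), M.E y (.inr d) → y ∈ S
  ord : S ≃ Fin S.card
  topological : ∀ s t : S, TransGen M.E s.1 t.1 → ord s < ord t

theorem edge_wf : WellFounded (TransGen M.E) := by
  have : IsTrans M.Node (TransGen M.E) := ⟨fun _ _ _ h h' => h.trans h'⟩
  have : Std.Irrefl (TransGen M.E) := ⟨M.acyclic⟩
  exact Finite.wellFounded_of_trans_of_irrefl _

theorem weight_nonneg (a : M.Assignment) : 0 ≤ M.weight a :=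
  Finset.prod_nonneg fun x _ => (M.cpd x _).2.1 _

theorem exists_cpd_pos (x : M.X) (c : M.Context (.inl x)) : ∃ v, 0 < (M.cpd x c).1 v := by
  by_contra h
  push Not at h
  have h1 := (M.cpd x c).2.2
  have h2 : ∑ v, (M.cpd x c).1 v ≤ 0 := Finset.sum_nonpos fun v _ => h v
  linarith

/-- Values can be chosen outside a set `K` so that the weight becomes positive. -/
theorem exists_weight_pos (a : M.Assignment) (K : Set M.Node)
    (hpos : ∀ x, Sum.inl x ∈ K → 0 < (M.cpd x (M.parents a (.inl x))).1 (a (.inl x)))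
    (hK : ∀ x y, Sum.inl x ∈ K → M.E y (.inl x) → y ∈ K) :
    ∃ b : M.Assignment, (∀ v ∈ K, b v = a v) ∧ (∀ d : M.D, b (.inr d) = a (.inr d)) ∧
      0 < M.weight b := by
  let step : ∀ v : M.Node, (∀ y, TransGen M.E y v → M.dom y) → M.dom v := fun v rec =>
    if v ∈ K then a v else
      match v, rec with
      | .inl x, rec => (M.exists_cpd_pos x fun y => rec y.1 (.single y.2)).choose
      | .inr d, _ => a (.inr d)
  let b : M.Assignment := fun v => M.edge_wf.fix step v
  have hb : ∀ v, b v = step v fun y _ => b y := fun v => M.edge_wf.fix_eq step v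
  have hbK : ∀ v ∈ K, b v = a v := fun v hv => by rw [hb]; simp only [step, if_pos hv]
  refine ⟨b, hbK, ?_, ?_⟩
  · intro d
    rw [hb]
    by_cases hd : (Sum.inr d : M.Node) ∈ K
    · simp only [step, if_pos hd]
    · simp only [step, if_neg hd]
  · refine Finset.prod_pos fun x _ => ?_
    by_cases hx : (Sum.inl x : M.Node) ∈ K
    · have : M.parents b (.inl x) = M.parents a (.inl x) := by
        funext y
        exact hbK _ (hK x y.1 hx y.2)
      rw [this, hbK _ hx]
      exact hpos x hx
    · have : b (.inl x) = (M.exists_cpd_pos x (M.parents b (.inl x))).choose := by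
        rw [hb]
        simp only [step, if_neg hx]
        rfl
      rw [this]
      exact (M.exists_cpd_pos x _).choose_spec

theorem cpd_pos_of_weight_pos (a : M.Assignment) (h : 0 < M.weight a) (x : M.X) :
    0 < (M.cpd x (M.parents a (.inl x))).1 (a (.inl x)) := by
  refine lt_of_le_of_ne ((M.cpd x _).2.1 _) fun h0 => ?_
  exact h.ne' (Finset.prod_eq_zero (Finset.mem_univ x) h0.symm)

namespace Splitting

variable {M} (T : M.Splitting)

/-- Instantiations of the first `k` splitting nodes. -/
abbrev Prefix (k : ℕ) : Type := ∀ s : {s : T.S // (T.ord s : ℕ) < k}, M.dom s.1.1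

/-- The instantiation of the first `k` splitting nodes in `a`. -/
def restrict (k : ℕ) (a : M.Assignment) : T.Prefix k := fun s => a s.1.1

/-- The product of the CPDs of the chance nodes, summed over all instantiations that agree with
`p`. Ratios of these sums are the conditional probabilities, given `p`, of the partial
distribution over the chance nodes. -/
def mass {k : ℕ} (p : T.Prefix k) : ℝ :=
  ∑ a : M.Assignment with T.restrict k a = p, M.weight a

theorem mass_pos_iff {k : ℕ} (p : T.Prefix k) :
    0 < T.mass p ↔ ∃ a, T.restrict k a = p ∧ 0 < M.weight a := by
  constructor
  · intro h
    obtain ⟨a, ha, h'⟩ := Finset.exists_lt_of_sum_lt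
      (f := fun _ : M.Assignment => (0 : ℝ)) (g := M.weight)
      (s := Finset.univ.filter fun a => T.restrict k a = p) (by rw [Finset.sum_const_zero]; exact h)
    exact ⟨a, by simpa using ha, h'⟩
  · rintro ⟨a, ha, h⟩
    exact Finset.sum_pos' (fun b _ => M.weight_nonneg b) ⟨a, by simpa using ha, h⟩

/-- Nodes of the game tree at depth `k` are the instantiations of the first `k` splitting nodes;
branches of probability zero are removed. -/
def TreeNode : Type := {p : Σ k : Fin (T.S.card + 1), T.Prefix k // 0 < T.mass p.2}

instance : Fintype T.TreeNode :=
  inferInstanceAs (Fintype {p : Σ k : Fin (T.S.card + 1), T.Prefix k // 0 < T.mass p.2})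

def depth (u : T.TreeNode) : ℕ := u.1.1

def lab (u : T.TreeNode) : T.Prefix (T.depth u) := u.1.2

theorem depth_le (u : T.TreeNode) : T.depth u ≤ T.S.card := Nat.lt_succ_iff.1 u.1.1.2

def mkNode (k : ℕ) (hk : k ≤ T.S.card) (a : M.Assignment) (ha : 0 < M.weight a) : T.TreeNode :=
  ⟨⟨⟨k, Nat.lt_succ_of_le hk⟩, T.restrict k a⟩, (T.mass_pos_iff _).2 ⟨a, rfl, ha⟩⟩

theorem eq_mkNode (u : T.TreeNode) (a : M.Assignment) (ha : 0 < M.weight a)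
    (h : T.restrict (T.depth u) a = T.lab u) : u = T.mkNode (T.depth u) (T.depth_le u) a ha := by
  obtain ⟨⟨k, p⟩, hp⟩ := u
  change T.restrict k a = p at h
  subst h
  rfl

theorem exists_eq_mkNode (u : T.TreeNode) :
    ∃ a, ∃ ha : 0 < M.weight a, u = T.mkNode (T.depth u) (T.depth_le u) a ha := by
  obtain ⟨a, h, ha⟩ := (T.mass_pos_iff (T.lab u)).1 u.2
  exact ⟨a, ha, T.eq_mkNode u a ha h⟩

/-- `w` extends the instantiation `u` by a value of one more splitting node. -/
def Child (u w : T.TreeNode) : Prop :=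
  T.depth w = T.depth u + 1 ∧
    ∀ (s : T.S) (h : (T.ord s : ℕ) < T.depth u) (h' : (T.ord s : ℕ) < T.depth w),
      T.lab w ⟨s, h'⟩ = T.lab u ⟨s, h⟩

theorem child_mkNode {u : T.TreeNode} {k : ℕ} (hk : k ≤ T.S.card) (hu : k = T.depth u + 1)
    (a : M.Assignment) (ha : 0 < M.weight a) (h : T.restrict (T.depth u) a = T.lab u) :
    T.Child u (T.mkNode k hk a ha) :=
  ⟨hu, fun s hs _ => congrFun h ⟨s, hs⟩⟩

theorem ext_node {u v : T.TreeNode} (hd : T.depth u = T.depth v)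
    (h : ∀ (s : T.S) (h : (T.ord s : ℕ) < T.depth u) (h' : (T.ord s : ℕ) < T.depth v),
      T.lab u ⟨s, h⟩ = T.lab v ⟨s, h'⟩) : u = v := by
  obtain ⟨⟨⟨k, hk⟩, p⟩, hp⟩ := u
  obtain ⟨⟨⟨l, hl⟩, q⟩, hq⟩ := v
  change k = l at hd
  subst hd
  have : p = q := funext fun s => h s.1 s.2 s.2
  subst this
  rfl

theorem child_parent_unique (u u' v : T.TreeNode) (h : T.Child u v) (h' : T.Child u' v) :
    u = u' := by
  have hd : T.depth u = T.depth u' := by have := h.1; have := h'.1; omega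
  refine T.ext_node hd fun s hs hs' => ?_
  have hv : (T.ord s : ℕ) < T.depth v := by have := h.1; omega
  rw [← h.2 s hs hv, ← h'.2 s hs' hv]

theorem exists_root : ∃ a : M.Assignment, 0 < M.weight a := by
  obtain ⟨b, -, -, hb⟩ := M.exists_weight_pos (fun v => Classical.arbitrary (M.dom v)) ∅
    (by simp) (by simp)
  exact ⟨b, hb⟩

def rootNode : T.TreeNode :=
  T.mkNode 0 (Nat.zero_le _) (exists_root (M := M)).choose (exists_root (M := M)).choose_spec

theorem child_reachable (v : T.TreeNode) : ReflTransGen T.Child T.rootNode v := by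
  obtain ⟨a, ha, hv⟩ := T.exists_eq_mkNode v
  rw [hv]
  have : ∀ k (hk : k ≤ T.S.card), ReflTransGen T.Child T.rootNode (T.mkNode k hk a ha) := by
    intro k
    induction k with
    | zero =>
      intro hk
      have : T.rootNode = T.mkNode 0 hk a ha :=
        T.ext_node rfl fun s hs _ => absurd hs (Nat.not_lt_zero _)
      rw [this]
    | succ k ih =>
      intro hk
      exact (ih (by omega)).tail (T.child_mkNode hk rfl a ha rfl)
  exact this _ _

/-- The splitting node whose value is determined at a node of the tree of depth less than the
number of splitting nodes. -/
def next (u : T.TreeNode) (h : T.depth u < T.S.card) : M.Node := (T.ord.symm ⟨T.depth u, h⟩).1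

theorem ord_next (u : T.TreeNode) (h : T.depth u < T.S.card) (s : T.S) (hs : s.1 = T.next u h) :
    (T.ord s : ℕ) = T.depth u := by
  have : s = T.ord.symm ⟨T.depth u, h⟩ := Subtype.ext hs
  simp [this]

/-- The decision context recorded at a node of the tree. -/
def contextAt (u : T.TreeNode) (d : M.D) (h : T.depth u < T.S.card)
    (hd : T.next u h = .inr d) : M.Context (.inr d) := fun y =>
  T.lab u ⟨⟨y.1, T.parent_mem d y.1 y.2⟩, by
    have h1 := T.topological ⟨y.1, T.parent_mem d y.1 y.2⟩ ⟨.inr d, T.dec_mem d⟩ (.single y.2)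
    have h2 := T.ord_next u h ⟨.inr d, T.dec_mem d⟩ hd.symm
    rw [← h2]
    exact h1⟩

/-- Information sets: decision nodes with a decision context that occurs in the tree. -/
def InfoSet : Type :=
  {I : Σ d : M.D, M.Context (.inr d) //
    ∃ (u : T.TreeNode) (h : T.depth u < T.S.card) (hd : T.next u h = .inr I.1),
      T.contextAt u I.1 h hd = I.2}

instance : Fintype T.InfoSet := inferInstanceAs (Fintype {I : Σ d : M.D, M.Context (.inr d) //
    ∃ (u : T.TreeNode) (h : T.depth u < T.S.card) (hd : T.next u h = .inr I.1),
      T.contextAt u I.1 h hd = I.2})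

def nodeKind (u : T.TreeNode) : NodeKind T.InfoSet :=
  if h : T.depth u < T.S.card then
    match hd : T.next u h with
    | .inl _ => .chance
    | .inr d => .decision ⟨⟨d, T.contextAt u d h hd⟩, u, h, hd, rfl⟩
  else .leaf

theorem nodeKind_leaf_iff (u : T.TreeNode) :
    T.nodeKind u = .leaf ↔ ¬ T.depth u < T.S.card := by
  unfold nodeKind
  split_ifs with h
  · split <;> simp [h]
  · simp [h]

theorem nodeKind_chance {u : T.TreeNode} (hu : T.nodeKind u = .chance) :
    T.depth u < T.S.card := by
  by_contra h
  rw [(T.nodeKind_leaf_iff u).2 h] at hu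
  cases hu

theorem nodeKind_decision_iff (u : T.TreeNode) (I : T.InfoSet) :
    T.nodeKind u = .decision I ↔
      ∃ (h : T.depth u < T.S.card) (hd : T.next u h = .inr I.1.1),
        T.contextAt u I.1.1 h hd = I.1.2 := by
  unfold nodeKind
  split_ifs with h
  · split
    · next x hx => simp [h, hx]
    · next d hd =>
      obtain ⟨⟨d', c⟩, hI⟩ := I
      constructor
      · intro h1
        injection h1 with h1
        have h2 := congrArg Subtype.val h1
        obtain ⟨rfl, h3⟩ := Sigma.mk.inj_iff.1 h2
        exact ⟨h, hd, eq_of_heq h3⟩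
      · rintro ⟨h', hd', hc⟩
        have : d = d' := by rw [hd] at hd'; exact Sum.inr_injective hd'
        subst this
        exact congrArg NodeKind.decision (Subtype.ext (Sigma.ext rfl (heq_of_eq hc)))
  · simp [h]

/-- The value that the child `w` of `u` gives to the decision node `d` decided at `u`. -/
def valueAt {u : T.TreeNode} (d : M.D) (h : T.depth u < T.S.card) (hd : T.next u h = .inr d)
    (w : {w // T.Child u w}) : M.dom (.inr d) :=
  T.lab w.1 ⟨⟨.inr d, T.dec_mem d⟩, by
    rw [T.ord_next u h _ hd.symm, w.2.1]; exact Nat.lt_succ_self _⟩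

theorem valueAt_bijective {u : T.TreeNode} (d : M.D) (h : T.depth u < T.S.card)
    (hd : T.next u h = .inr d) : Function.Bijective (T.valueAt (u := u) d h hd) := by
  constructor
  · rintro ⟨w, hw⟩ ⟨w', hw'⟩ he
    refine Subtype.ext (T.ext_node (hw.1.trans hw'.1.symm) fun s hs hs' => ?_)
    by_cases hlt : (T.ord s : ℕ) < T.depth u
    · rw [hw.2 s hlt hs, hw'.2 s hlt hs']
    · have h1 : T.ord s = T.ord ⟨.inr d, T.dec_mem d⟩ := by
        apply Fin.ext
        rw [T.ord_next u h ⟨.inr d, T.dec_mem d⟩ hd.symm]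
        have h3 : T.depth w = T.depth u + 1 := hw.1
        change (T.ord s : ℕ) < T.depth w at hs
        omega
      have h2 := T.ord.injective h1
      subst h2
      exact he
  · intro v
    obtain ⟨a, ha, hu⟩ := T.exists_eq_mkNode u
    have hres : T.restrict (T.depth u) a = T.lab u := by
      obtain ⟨b, hb, hb'⟩ := (T.mass_pos_iff (T.lab u)).1 u.2
      have key : ∀ w : T.TreeNode, u = w → ∀ s (hs : (T.ord s : ℕ) < T.depth u)
          (hs' : (T.ord s : ℕ) < T.depth w), T.lab u ⟨s, hs⟩ = T.lab w ⟨s, hs'⟩ := by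
        rintro w rfl s hs hs'; rfl
      funext s
      exact (key _ hu s.1 s.2 s.2).symm
    let K : Set M.Node := {y | ¬ TransGen M.E (.inr d) y}
    have hne : ∀ x y, (Sum.inl x : M.Node) ∈ K → M.E y (.inl x) → y ≠ .inr d := by
      rintro x y hx hy rfl
      exact hx (.single hy)
    obtain ⟨b, hbK, hbd, hb⟩ := M.exists_weight_pos (Function.update a (.inr d) v) K
      (by
        intro x hx
        have : M.parents (Function.update a (.inr d) v) (.inl x) = M.parents a (.inl x) := by
          funext y
          exact Function.update_of_ne (hne x y.1 hx y.2) _ _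
        rw [this, Function.update_of_ne (by simp)]
        exact M.cpd_pos_of_weight_pos a ha x)
      (by
        intro x y hx hy hdy
        exact hx (hdy.tail hy))
    have hbres : T.restrict (T.depth u) b = T.lab u := by
      rw [← hres]
      funext s
      have hne' : s.1.1 ≠ .inr d := by
        intro he
        have h1 := s.2
        rw [T.ord_next u h s.1 (he.trans hd.symm)] at h1
        exact lt_irrefl _ h1
      have hsK : s.1.1 ∈ K := by
        intro ht
        have h1 := T.topological ⟨.inr d, T.dec_mem d⟩ s.1 ht
        have h2 := T.ord_next u h ⟨.inr d, T.dec_mem d⟩ hd.symm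
        have h3 := s.2
        have h4 : (T.ord ⟨.inr d, T.dec_mem d⟩ : ℕ) < T.ord s.1 := h1
        omega
      change b s.1.1 = a s.1.1
      rw [hbK _ hsK, Function.update_of_ne hne']
    refine ⟨⟨T.mkNode (T.depth u + 1) h b hb, T.child_mkNode h rfl b hb hbres⟩, ?_⟩
    change b (.inr d) = v
    rw [hbd, Function.update_self]

theorem sum_mass_child (u : T.TreeNode) (h : T.depth u < T.S.card) :
    ∑ w : {w // T.Child u w}, T.mass (T.lab w.1) = T.mass (T.lab u) := by
  unfold mass
  simp only [Finset.sum_filter]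
  rw [Finset.sum_comm]
  refine Finset.sum_congr rfl fun a _ => ?_
  rcases (M.weight_nonneg a).eq_or_lt with ha | ha
  · simp [← ha]
  by_cases hu : T.restrict (T.depth u) a = T.lab u
  · rw [if_pos hu, Finset.sum_eq_single ⟨_, T.child_mkNode (k := T.depth u + 1) h rfl a ha hu⟩]
    · exact if_pos rfl
    · rintro ⟨w, hw⟩ - hne
      refine if_neg fun hw' => hne (Subtype.ext ?_)
      refine T.ext_node hw.1 fun s hs hs' => ?_
      exact (congrFun hw' ⟨s, hs⟩).symm
    · simp
  · rw [if_neg hu]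
    refine Finset.sum_eq_zero ?_
    rintro ⟨w, hw⟩ -
    refine if_neg fun hw' => hu ?_
    funext s
    have hs' : (T.ord s.1 : ℕ) < T.depth w := by have := s.2; have := hw.1; omega
    rw [← hw.2 s.1 s.2 hs']
    exact congrFun hw' ⟨s.1, hs'⟩

/-- The game obtained by splitting on the nodes of `S` in the chosen order. A child of a chance
node gets the conditional probability of the value chosen, given the instantiation so far. The
payoff at a leaf is the sum of the player's utility nodes given the instantiation of the
splitting nodes at the leaf; if `S` does not contain all parents of a utility node, its value is
averaged over the chance nodes outside `S`. -/
def toEFG : EFG n where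
  V := T.TreeNode
  E := T.Child
  root := T.rootNode
  no_parent_root := fun u h => Nat.succ_ne_zero _ h.1.symm
  parent_unique := T.child_parent_unique
  reachable := T.child_reachable
  Info := T.InfoSet
  player := fun I => M.owner I.1.1
  kind := T.nodeKind
  leaf_iff := fun u => by
    rw [T.nodeKind_leaf_iff]
    constructor
    · intro h w hw
      have := hw.1
      have := T.depth_le w
      omega
    · intro h hlt
      obtain ⟨a, hr, ha⟩ := (T.mass_pos_iff (T.lab u)).1 u.2
      exact h _ (T.child_mkNode (k := T.depth u + 1) hlt rfl a ha hr)
  info_nonempty := fun I => by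
    obtain ⟨u, h⟩ := I.2
    exact ⟨u, (T.nodeKind_decision_iff u I).2 h⟩
  P := fun {u} hu => ⟨fun w => T.mass (T.lab w.1) / T.mass (T.lab u),
    fun w => div_nonneg w.1.2.le u.2.le, by
      rw [← Finset.sum_div, T.sum_mass_child u (T.nodeKind_chance hu)]
      exact div_self u.2.ne'⟩
  Act := fun I => M.dom (.inr I.1.1)
  label := fun {u I} hu =>
    Equiv.ofBijective
      (T.valueAt I.1.1 ((T.nodeKind_decision_iff u I).1 hu).choose
        ((T.nodeKind_decision_iff u I).1 hu).choose_spec.choose)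
      (T.valueAt_bijective _ _ _)
  U := fun L i => ∑ j : M.U with M.ownerU j = i,
    (∑ a : M.Assignment with T.restrict (T.depth L.1) a = T.lab L.1, M.weight a * M.utilVal j a) /
      T.mass (T.lab L.1)

end Splitting

end MAIM

/-- The set of games obtained from a model by choosing the splitting nodes and their order. -/
def maim2efg {n : ℕ} (M : MAIM n) : Set (EFG n) := Set.range fun T : M.Splitting => T.toEFG

/-! ### From games to models -/

namespace EFG

variable {n : ℕ} (G : EFG n)

/-- A grouping of the chance nodes into chance variables and of the information sets into decision
variables, each with a set of values. All members of a variable have the same number of outgoing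
edges, and these are labelled by the values of the variable. -/
structure Grouping where
  C : Type
  D : Type
  [fintypeC : Fintype C]
  [fintypeD : Fintype D]
  cvar : {v // G.kind v = .chance} → C
  dvar : G.Info → D
  cvar_surj : Function.Surjective cvar
  dvar_surj : Function.Surjective dvar
  owner : D → Fin n
  owner_dvar : ∀ I, owner (dvar I) = G.player I
  cval : C → Type
  dval : D → Type
  [fintypeCval : ∀ c, Fintype (cval c)]
  [fintypeDval : ∀ d, Fintype (dval d)]
  clabel : ∀ v : {v // G.kind v = .chance}, {w // G.E v.1 w} ≃ cval (cvar v)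
  dlabel : ∀ I : G.Info, G.Act I ≃ dval (dvar I)

attribute [instance] Grouping.fintypeC Grouping.fintypeD Grouping.fintypeCval Grouping.fintypeDval

namespace Grouping

variable {G} (J : G.Grouping)

abbrev Var : Type := J.C ⊕ J.D

/-- The labels of the outgoing edges of the members of a variable. -/
def val : J.Var → Type
  | .inl c => J.cval c
  | .inr d => J.dval d

/-- The domains of the variables: chance variables have an additional null value `none`. -/
def dom : J.Var → Type
  | .inl c => Option (J.cval c)
  | .inr d => J.dval d

def toDom : ∀ x : J.Var, J.val x → J.dom x
  | .inl _, v => some v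
  | .inr _, v => v

instance fintypeDom : ∀ x : J.Var, Fintype (J.dom x)
  | .inl c => inferInstanceAs (Fintype (Option (J.cval c)))
  | .inr d => inferInstanceAs (Fintype (J.dval d))

/-- The variable of a non-leaf node, with the label of one of its outgoing edges. -/
def edgeLabel (u : G.V) (w : {w // G.E u w}) : Σ x : J.Var, J.val x :=
  match h : G.kind u with
  | .leaf => ((G.leaf_iff u).1 h w.1 w.2).elim
  | .chance => ⟨.inl (J.cvar ⟨u, h⟩), J.clabel ⟨u, h⟩ w⟩
  | .decision I => ⟨.inr (J.dvar I), J.dlabel I (G.label h w)⟩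

/-- The labels along the path from the root to `v`. -/
def path (v : G.V) : Set (Σ x : J.Var, J.val x) :=
  {p | ∃ (u : G.V) (w : {w // G.E u w}), ReflTransGen G.E w.1 v ∧ J.edgeLabel u w = p}

/-- The variables of the strict ancestors of `v`. -/
def ancestors (v : G.V) : Set J.Var := Sigma.fst '' J.path v

/-- What is known at an information set: the labels that occur on all paths into it. -/
def known (I : G.Info) : Set (Σ x : J.Var, J.val x) :=
  {p | ∀ v, G.kind v = .decision I → p ∈ J.path v}

/-- The variables whose values are known at an information set. -/
def knownVars (I : G.Info) : Set J.Var := Sigma.fst '' J.known I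

/-- The edges of the influence diagram between chance and decision variables. -/
def Parent (y : J.Var) : J.Var → Prop
  | .inl c => ∃ v, J.cvar v = c ∧ y ∈ J.ancestors v.1
  | .inr d => ∃ I, J.dvar I = d ∧ y ∈ J.knownVars I

end Grouping

/-- A partition of the chance nodes and of the information sets into intervention sets. -/
structure InterventionSets extends Grouping G where
  /-- no path passes through an intervention set more than once -/
  once : ∀ (u : G.V) (w : {w // G.E u w}) (u' : G.V) (w' : {w // G.E u' w}),
    ReflTransGen G.E w.1 u' → (toGrouping.edgeLabel u w).1 ≠ (toGrouping.edgeLabel u' w').1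
  /-- the values of the same variables are known at all information sets of an intervention set -/
  same_knowledge : ∀ I I', dvar I = dvar I' → toGrouping.knownVars I = toGrouping.knownVars I'
  /-- what is known tells the information sets of an intervention set apart -/
  separated : ∀ I I', dvar I = dvar I' → toGrouping.known I = toGrouping.known I' → I = I'
  /-- the merged graph is a directed acyclic graph -/
  acyclic : ∀ x, ¬ TransGen toGrouping.Parent x x

namespace Grouping

variable {G} (J : G.Grouping)

/-- The instantiation `c` of the variables in `R` contains all the labels in `p`. -/
def Consistent (R : J.Var → Prop) (c : ∀ y : {y // R y}, J.dom y.1)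
    (p : Set (Σ x : J.Var, J.val x)) : Prop :=
  ∀ q ∈ p, ∃ h : R q.1, c ⟨q.1, h⟩ = J.toDom q.1 q.2

theorem toDom_injective (x : J.Var) : Function.Injective (J.toDom x) := by
  cases x with
  | inl c => exact Option.some_injective _
  | inr d => exact Function.injective_id

/-- The total probability of the edges labelled `v` out of those chance nodes of the variable `x`
whose path is consistent with the instantiation `c` of the parents. -/
def labelProb (x : J.C) (c : ∀ y : {y // J.Parent y (.inl x)}, J.dom y.1) (v : J.cval x) : ℝ :=
  ∑ u : {u // G.kind u = .chance}, ∑ w : {w // G.E u.1 w},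
    if J.edgeLabel u.1 w = ⟨.inl x, v⟩ ∧ J.Consistent _ c (J.path u.1)
      then (G.P u.2).1 w else 0

/-- The CPD of a chance variable: the null value is taken if no other value is possible. -/
def cpdFun (x : J.C) (c : ∀ y : {y // J.Parent y (.inl x)}, J.dom y.1) :
    Option (J.cval x) → ℝ
  | some v => J.labelProb x c v
  | none => if ∀ v, J.labelProb x c v = 0 then 1 else 0

theorem edgeLabel_chance (u : {u // G.kind u = .chance}) (w : {w // G.E u.1 w}) :
    J.edgeLabel u.1 w = ⟨.inl (J.cvar u), J.clabel u w⟩ := by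
  obtain ⟨u, hu⟩ := u
  unfold edgeLabel
  split
  · next h => rw [hu] at h; cases h
  · rfl
  · next I h => rw [hu] at h; cases h

theorem edgeLabel_fst (u : G.V) (w w' : {w // G.E u w}) :
    (J.edgeLabel u w).1 = (J.edgeLabel u w').1 := by
  unfold edgeLabel
  split
  · next h => exact ((G.leaf_iff u).1 h w.1 w.2).elim
  · rfl
  · rfl

theorem edgeLabel_injective (u : G.V) : Function.Injective (J.edgeLabel u) := by
  intro w w' h
  unfold edgeLabel at h
  split at h
  · next h' => exact ((G.leaf_iff u).1 h' w.1 w.2).elim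
  · exact (J.clabel _).injective (eq_of_heq (Sigma.mk.inj_iff.1 h).2)
  · exact (G.label _).injective ((J.dlabel _).injective (eq_of_heq (Sigma.mk.inj_iff.1 h).2))

end Grouping

theorem E_head_induction {v : G.V} {p : G.V → Prop} (h : ∀ u, (∀ w, G.E w u → p w) → p u) :
    p v := by
  have hv := G.reachable v
  induction hv with
  | refl => exact h _ fun w hw => (G.no_parent_root w hw).elim
  | tail _ hE ih =>
    refine h _ fun w hw => ?_
    rw [G.parent_unique _ _ _ hw hE]
    exact ih

/-- Two nodes are comparable in the tree, or their paths diverge. -/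
theorem comparable_or_diverge (u v : G.V) :
    ReflTransGen G.E u v ∨ ReflTransGen G.E v u ∨
      ∃ (z : G.V) (w w' : {w // G.E z w}), w ≠ w' ∧ ReflTransGen G.E w.1 u ∧
        ReflTransGen G.E w'.1 v := by
  have hu := G.reachable u
  induction hu with
  | refl => exact Or.inl (G.reachable v)
  | @tail b c _ hE ih =>
    rcases ih with h | h | ⟨z, w, w', hne, h, h'⟩
    · rcases h.cases_head with rfl | ⟨d, hd, hdv⟩
      · exact Or.inr (Or.inl (.single hE))
      · by_cases hcd : c = d
        · subst hcd
          exact Or.inl hdv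
        · exact Or.inr (Or.inr ⟨b, ⟨c, hE⟩, ⟨d, hd⟩, fun h => hcd (congrArg Subtype.val h),
            .refl, hdv⟩)
    · exact Or.inr (Or.inl (h.tail hE))
    · exact Or.inr (Or.inr ⟨z, w, w', hne, h.tail hE, h'⟩)

namespace InterventionSets

variable {G} (J : G.InterventionSets)

/-- At most one node of a chance variable has a path that is consistent with an instantiation. -/
theorem consistent_unique (R : J.Var → Prop) (c : ∀ y : {y // R y}, J.dom y.1)
    (u u' : {u // G.kind u = .chance}) (hv : J.cvar u = J.cvar u')
    (h : J.Consistent R c (J.path u.1)) (h' : J.Consistent R c (J.path u'.1)) : u = u' := by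
  have hchild : ∀ v : {u // G.kind u = .chance}, Nonempty {w // G.E v.1 w} := by
    intro v
    by_contra hne
    have := (G.leaf_iff v.1).2 fun w hw => hne ⟨⟨w, hw⟩⟩
    rw [v.2] at this
    cases this
  have key : ∀ v v' : {u // G.kind u = .chance}, J.cvar v = J.cvar v' →
      ReflTransGen G.E v.1 v'.1 → v = v' := by
    intro v v' hvv hr
    rcases hr.cases_head with he | ⟨d, hd, hdv⟩
    · exact Subtype.ext he
    · obtain ⟨w'⟩ := hchild v'
      refine (J.once v.1 ⟨d, hd⟩ v'.1 w' hdv ?_).elim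
      rw [J.edgeLabel_chance v, J.edgeLabel_chance v']
      exact congrArg Sum.inl hvv
  rcases G.comparable_or_diverge u.1 u'.1 with hr | hr | ⟨z, w, w', hne, hw, hw'⟩
  · exact key _ _ hv hr
  · exact (key _ _ hv.symm hr).symm
  · refine (hne (J.edgeLabel_injective z ?_)).elim
    obtain ⟨h1, e1⟩ := h _ ⟨z, w, hw, rfl⟩
    obtain ⟨h2, e2⟩ := h' _ ⟨z, w', hw', rfl⟩
    have hfst := J.edgeLabel_fst z w w'
    generalize J.edgeLabel z w = p at *
    generalize J.edgeLabel z w' = q at *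
    obtain ⟨x, a⟩ := p
    obtain ⟨y, b⟩ := q
    change x = y at hfst
    subst hfst
    exact congrArg (Sigma.mk x) (J.toDom_injective x (e1.symm.trans e2))

theorem sum_labelProb (x : J.C) (c : ∀ y : {y // J.Parent y (.inl x)}, J.dom y.1)
    (u : {u // G.kind u = .chance}) (hu : J.cvar u = x)
    (hc : J.Consistent _ c (J.path u.1)) : ∑ v, J.labelProb x c v = 1 := by
  subst hu
  have h1 : ∀ v, J.labelProb (J.cvar u) c v = (G.P u.2).1 ((J.clabel u).symm v) := by
    intro v
    unfold Grouping.labelProb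
    rw [Finset.sum_eq_single u, Finset.sum_eq_single ((J.clabel u).symm v)]
    · refine if_pos ⟨?_, hc⟩
      rw [J.edgeLabel_chance, Equiv.apply_symm_apply]
    · intro w _ hw
      refine if_neg fun h => hw ?_
      have h2 := h.1
      rw [J.edgeLabel_chance] at h2
      have h3 := eq_of_heq (Sigma.mk.inj_iff.1 h2).2
      rw [← h3]
      exact ((J.clabel u).symm_apply_apply w).symm
    · simp
    · intro u' _ hu'
      refine Finset.sum_eq_zero fun w _ => if_neg fun h => hu' ?_
      have h2 := h.1
      rw [J.edgeLabel_chance] at h2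
      exact J.consistent_unique _ c u' u (Sum.inl_injective (Sigma.mk.inj_iff.1 h2).1) h.2 hc
    · simp
  simp only [h1]
  rw [Equiv.sum_comp (J.clabel u).symm fun w => (G.P u.2).1 w]
  exact (G.P u.2).2.2

theorem cpdFun_mem (x : J.C) (c : ∀ y : {y // J.Parent y (.inl x)}, J.dom y.1) :
    J.cpdFun x c ∈ stdSimplex ℝ (Option (J.cval x)) := by
  have hnn : ∀ v, 0 ≤ J.labelProb x c v := fun v =>
    Finset.sum_nonneg fun u _ => Finset.sum_nonneg fun w _ => by
      split_ifs
      · exact (G.P u.2).2.1 w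
      · exact le_rfl
  constructor
  · rintro (_ | v)
    · change (0 : ℝ) ≤ if _ then 1 else 0
      split_ifs <;> norm_num
    · exact hnn v
  · rw [Fintype.sum_option]
    change (if ∀ v, J.labelProb x c v = 0 then (1 : ℝ) else 0) + ∑ v, J.labelProb x c v = 1
    split_ifs with h
    · simp [h]
    · push Not at h
      obtain ⟨v, hv⟩ := h
      obtain ⟨u, -, hu⟩ := Finset.exists_ne_zero_of_sum_ne_zero hv
      obtain ⟨w, -, hw⟩ := Finset.exists_ne_zero_of_sum_ne_zero hu
      have hw' := (ite_ne_right_iff.1 hw).1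
      have h2 := hw'.1
      rw [J.edgeLabel_chance] at h2
      rw [zero_add]
      exact J.sum_labelProb x c u (Sum.inl_injective (Sigma.mk.inj_iff.1 h2).1) hw'.2

theorem nonempty_dom : ∀ x : J.Var, Nonempty (J.dom x)
  | .inl _ => ⟨(none : Option _)⟩
  | .inr d => by
    obtain ⟨I, rfl⟩ := J.dvar_surj d
    obtain ⟨u, hu⟩ := G.info_nonempty I
    by_contra hne
    have := (G.leaf_iff u).2 fun w hw => hne ⟨J.dlabel I (G.label hu ⟨w, hw⟩)⟩
    rw [hu] at this
    cases this

end InterventionSets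

end EFG

/-- The influence model of a game with intervention sets. A leaf gives a utility node for every
player, with the variables of all its ancestors as parents; utility nodes of a player with the same
parents are merged. A utility node has the payoff of the leaf whose path agrees with the
instantiation of the parents (there is at most one), and the value `0` if there is none. -/
def efg2maim {n : ℕ} (G : EFG n) (J : G.InterventionSets) : MAIM n where
  X := J.C
  D := J.D
  U := Fin n × {s : Set J.Var // ∃ L, G.kind L = .leaf ∧ s = J.ancestors L}
  owner := J.owner
  ownerU := fun j => j.1
  E := J.Parent
  EU := fun y j => y ∈ j.2.1
  acyclic := J.acyclic
  dom := J.dom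
  nonemptyDom := J.nonempty_dom
  cpd := fun x c => ⟨J.cpdFun x c, J.cpdFun_mem x c⟩
  util := fun j c => ∑ L : {v // G.kind v = .leaf},
    if J.ancestors L.1 = j.2.1 ∧ J.Consistent (fun y => y ∈ j.2.1) c (J.path L.1)
      then G.U L j.1 else 0

end

open Filter Topology Relation

noncomputable section

open scoped Classical

/-! In both constructions the information sets of the game correspond injectively to some of the
decision contexts of the model, with the same decisions and the same player: this is an
`InfoEmbedding`. A policy profile then restricts to a strategy profile, and everything rests on one
identity, `PreservesUtility`: restriction leaves all expected utilities unchanged. It makes every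
decision context outside the embedding null, so the fibres of `restrict` are the classes of a
natural mapping.

Perturbed equilibria correspond because deviations do: by `isPerturbedNE_iff`, those of the model
are the extensions of those of the game by any admissible behaviour off the embedding. Hence THPEs
restrict to THPEs (`isTHPE_restrict`). Conversely, equilibria that approximate the restriction of
`π` extend to equilibria that approximate `π`, if `π` mixed with a vanishing uniform tremble is
played off the embedding (`isTHPE_of_restrict`).

The identity itself compares path probabilities in the tree with the joint distribution of the
model. The tool is `sum_mul_prod_kernel`: in a product of conditional distributions along an acyclic
graph, the factors of a descendant-closed set of nodes may be made uniform when the rest of the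
summand ignores these nodes. For `maim2efg` it shows that the mass of an instantiation splits evenly
over the values of the next decision node, so that path probabilities are masses times policy
factors, up to the number of values of the undecided nodes (`pathProb_mkNode`). For `efg2maim` the
factors of the variables on a path are the edge probabilities, and the remaining factors sum to one
(`sum_prob_agrees`). -/

/-- A dependent function can be prescribed along an injective map. -/
theorem Function.Injective.exists_dependent_extension {ι κ : Type*} {β : κ → Type*} {e : ι → κ}
    (he : Function.Injective e) (g : ∀ i, β (e i)) (f₀ : ∀ k, β k) :
    ∃ f : ∀ k, β k, (∀ i, f (e i) = g i) ∧ ∀ k, k ∉ Set.range e → f k = f₀ k := by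
  refine ⟨fun k => if h : ∃ i, e i = k then h.choose_spec ▸ g h.choose else f₀ k, ?_, ?_⟩
  · intro i
    have h : ∃ j, e j = e i := ⟨i, rfl⟩
    simp only [dif_pos h]
    -- Stated for a variable `j`, so that injectivity can replace `j` by `i` and the transport
    -- becomes trivial.
    have key : ∀ j (hj : e j = e i), hj ▸ g j = g i := by
      intro j hj
      obtain rfl := he hj
      rfl
    exact key _ h.choose_spec
  · intro k hk
    exact dif_neg hk

/-! ### Embeddings of information sets into decision contexts, and the natural mapping -/

/-- An identification of the information sets of a game with some of the decision contexts of an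
influence model, and of the decisions available there. -/
structure InfoEmbedding {n : ℕ} (G : EFG n) (M : MAIM n) where
  dec : G.Info → M.D
  ctx : ∀ I, M.Context (.inr (dec I))
  act : ∀ I, G.Act I ≃ M.dom (.inr (dec I))
  inj : Function.Injective fun I => (⟨dec I, ctx I⟩ : Σ d : M.D, M.Context (.inr d))
  owner_dec : ∀ I, M.owner (dec I) = G.player I

namespace InfoEmbedding

variable {n : ℕ} {G : EFG n} {M : MAIM n} (e : InfoEmbedding G M)

/-- The strategy profile that a policy profile prescribes at the embedded information sets. -/
def restrict (π : M.Policy) : G.Strategy := fun I =>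
  ⟨fun t => (π (e.dec I) (e.ctx I)).1 (e.act I t),
    fun t => (π (e.dec I) (e.ctx I)).2.1 _, by
      rw [Equiv.sum_comp (e.act I) (π (e.dec I) (e.ctx I)).1]
      exact (π (e.dec I) (e.ctx I)).2.2⟩

/-- The decision contexts that do not correspond to an information set. -/
def Off (d : M.D) (c : M.Context (.inr d)) : Prop :=
  (⟨d, c⟩ : Σ d : M.D, M.Context (.inr d)) ∉
    Set.range fun I => (⟨e.dec I, e.ctx I⟩ : Σ d : M.D, M.Context (.inr d))

/-- The case distinction behind every claim about all decision contexts: on the embedding such a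
claim comes from the game, off it from a free choice. -/
theorem forall_context {p : ∀ d : M.D, M.Context (.inr d) → Prop}
    (h : ∀ I, p (e.dec I) (e.ctx I)) (h' : ∀ d c, e.Off d c → p d c) (d : M.D)
    (c : M.Context (.inr d)) : p d c := by
  by_cases hc : e.Off d c
  · exact h' d c hc
  · obtain ⟨I, hI⟩ := not_not.1 hc
    have key : ∀ s : Σ d : M.D, M.Context (.inr d),
        (⟨e.dec I, e.ctx I⟩ : Σ d : M.D, M.Context (.inr d)) = s → p s.1 s.2 := by
      rintro s rfl
      exact h I
    exact key _ hI

theorem exists_extension {β : ∀ d : M.D, M.Context (.inr d) → Type}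
    (g : ∀ I, β (e.dec I) (e.ctx I)) (f₀ : ∀ d c, β d c) :
    ∃ f : ∀ d c, β d c, (∀ I, f (e.dec I) (e.ctx I) = g I) ∧
      ∀ d c, e.Off d c → f d c = f₀ d c := by
  have key : ∃ f : ∀ s : Σ d : M.D, M.Context (.inr d), β s.1 s.2,
      (∀ I, f ⟨e.dec I, e.ctx I⟩ = g I) ∧
        ∀ s : Σ d : M.D, M.Context (.inr d), e.Off s.1 s.2 → f s = f₀ s.1 s.2 :=
    e.inj.exists_dependent_extension (β := fun s => β s.1 s.2) g (fun s => f₀ s.1 s.2)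
  obtain ⟨f, hf, hf'⟩ := key
  exact ⟨fun d c => f ⟨d, c⟩, hf, fun d c h => hf' ⟨d, c⟩ h⟩

/-- A distribution over the decisions of an information set, as one over the values of the
decision node. -/
def push (I : G.Info) (q : stdSimplex ℝ (G.Act I)) : stdSimplex ℝ (M.dom (.inr (e.dec I))) :=
  ⟨fun t => q.1 ((e.act I).symm t), fun _ => q.2.1 _, by
    rw [Equiv.sum_comp (e.act I).symm q.1]
    exact q.2.2⟩

/-- The free choice of `π₀` serves twice: to lift a deviation without changing anything else, and to
put trembles off the embedding. -/
theorem exists_policy (σ : G.Strategy) (π₀ : M.Policy) :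
    ∃ π : M.Policy, (∀ I, π (e.dec I) (e.ctx I) = e.push I (σ I)) ∧ e.restrict π = σ ∧
      ∀ d c, e.Off d c → π d c = π₀ d c := by
  obtain ⟨π, h, h'⟩ := e.exists_extension (β := fun d _ => stdSimplex ℝ (M.dom (.inr d)))
    (fun I => e.push I (σ I)) π₀
  refine ⟨π, h, ?_, h'⟩
  funext I
  apply Subtype.ext
  funext t
  change (π (e.dec I) (e.ctx I)).1 (e.act I t) = _
  rw [h]
  exact congrArg (σ I).1 ((e.act I).symm_apply_apply t)

theorem push_restrict (π : M.Policy) (I : G.Info) :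
    e.push I (e.restrict π I) = π (e.dec I) (e.ctx I) := by
  apply Subtype.ext
  funext t
  exact congrArg (π (e.dec I) (e.ctx I)).1 ((e.act I).apply_symm_apply t)

/-- Restriction respects the payoffs. -/
def PreservesUtility : Prop :=
  ∀ π i, G.expectedUtility i (e.restrict π) = M.expectedUtility i π

theorem restrict_eq_iff (π π' : M.Policy) :
    e.restrict π = e.restrict π' ↔ ∀ I, π (e.dec I) (e.ctx I) = π' (e.dec I) (e.ctx I) := by
  constructor
  · intro h I
    rw [← e.push_restrict π, ← e.push_restrict π', h]
  · intro h
    funext I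
    apply Subtype.ext
    funext t
    exact congrFun (congrArg Subtype.val (h I)) _

theorem exists_base_policy (M : MAIM n) : Nonempty M.Policy :=
  ⟨fun _ _ => ⟨Pi.single (Classical.arbitrary _) 1, single_mem_stdSimplex ℝ _⟩⟩

theorem restrict_surjective : Function.Surjective e.restrict := fun σ =>
  have ⟨π₀⟩ := exists_base_policy M
  have ⟨π, _, h, _⟩ := e.exists_policy σ π₀
  ⟨π, h⟩

/-- Policy profiles are identified if they agree at the embedded information sets. -/
def naturalMapping (he : e.PreservesUtility) : NaturalMapping G M where
  rel := Setoid.ker e.restrict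
  map := (Setoid.quotientKerEquivOfSurjective e.restrict e.restrict_surjective).symm
  null_of_rel := by
    intro π π' h d c hne
    have hoff : e.Off d c := by
      rintro ⟨I, hI⟩
      have key : ∀ s : Σ d : M.D, M.Context (.inr d),
          (⟨e.dec I, e.ctx I⟩ : Σ d : M.D, M.Context (.inr d)) = s → π s.1 s.2 = π' s.1 s.2 := by
        rintro s rfl
        exact (e.restrict_eq_iff π π').1 h I
      exact hne (key _ hI)
    -- Feasibility plays no role: profiles that differ only in a context off the embedding have the
    -- same restriction, hence the same utilities.
    refine Or.inr fun ρ ρ' hρ i => ?_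
    rw [← he, ← he, (e.restrict_eq_iff ρ ρ').2 fun I => hρ _ _ fun hI => hoff ⟨I, hI⟩]
  utility_eq := by
    intro σ π h i
    rw [← he]
    rw [Equiv.eq_symm_apply] at h
    rw [← h]
    rfl

theorem mem_image_iff (he : e.PreservesUtility) (σ : G.Strategy) (π : M.Policy) :
    π ∈ (e.naturalMapping he).image σ ↔ e.restrict π = σ := by
  change Quotient.mk _ π = (Setoid.quotientKerEquivOfSurjective _ _).symm σ ↔ _
  rw [Equiv.eq_symm_apply]
  rfl

/-! ### Nash equilibria of perturbed games and models -/

/-- Restriction of perturbation vectors. -/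
def restrictPerturbation (δ : M.PerturbationVector) : G.PerturbationVector :=
  fun I t => δ (e.dec I) (e.ctx I) (e.act I t)

theorem isPerturbation_restrict {δ : M.PerturbationVector} (h : M.IsPerturbation δ) :
    G.IsPerturbation (e.restrictPerturbation δ) := by
  refine ⟨fun I t => (h.1 _ _ _).1, fun I => ?_⟩
  rw [show ∑ t, e.restrictPerturbation δ I t = ∑ v, δ (e.dec I) (e.ctx I) v from
    Equiv.sum_comp (e.act I) _]
  exact h.2 _ _

theorem mem_perturbed_iff (δ : M.PerturbationVector) (π : M.Policy) :
    π ∈ M.Perturbed δ ↔ e.restrict π ∈ G.Perturbed (e.restrictPerturbation δ) ∧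
      ∀ d c, e.Off d c → ∀ v, δ d c v ≤ (π d c).1 v := by
  constructor
  · exact fun h => ⟨fun I t => h _ _ _, fun d c _ v => h d c v⟩
  · rintro ⟨h, h'⟩
    refine e.forall_context (fun I v => ?_) h'
    have := h I ((e.act I).symm v)
    simpa [restrictPerturbation, restrict] using this

/-- Nash equilibria of a perturbed model are the admissible extensions of Nash equilibria of the
perturbed game. -/
theorem isPerturbedNE_iff (he : e.PreservesUtility) (δ : M.PerturbationVector) (π : M.Policy) :
    M.IsPerturbedNE δ π ↔ G.IsPerturbedNE (e.restrictPerturbation δ) (e.restrict π) ∧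
      ∀ d c, e.Off d c → ∀ v, δ d c v ≤ (π d c).1 v := by
  constructor
  · rintro ⟨hmem, hne⟩
    obtain ⟨h1, h2⟩ := (e.mem_perturbed_iff δ π).1 hmem
    refine ⟨⟨h1, fun i τ hτ hdev => ?_⟩, h2⟩
    -- The deviation `τ` is lifted with `π` kept off the embedding, so the lift stays admissible
    -- there and changes only decisions of player `i`.
    obtain ⟨ρ, hρ, hρτ, hoff⟩ := e.exists_policy τ π
    rw [← hρτ, he, he]
    refine hne i ρ ((e.mem_perturbed_iff δ ρ).2 ⟨hρτ ▸ hτ, fun d c h => ?_⟩) fun d hd => ?_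
    · rw [hoff d c h]
      exact h2 d c h
    · funext c
      revert hd
      refine e.forall_context (p := fun d c => M.owner d ≠ i → ρ d c = π d c) (fun I hI => ?_)
        (fun d c h _ => hoff d c h) d c
      rw [hρ, hdev I (e.owner_dec I ▸ hI), e.push_restrict]
  · rintro ⟨⟨h1, hne⟩, h2⟩
    refine ⟨(e.mem_perturbed_iff δ π).2 ⟨h1, h2⟩, fun i τ hτ hdev => ?_⟩
    rw [← he, ← he]
    refine hne i _ ((e.mem_perturbed_iff δ τ).1 hτ).1 fun I hI => ?_
    apply Subtype.ext
    funext t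
    change (τ (e.dec I) (e.ctx I)).1 _ = (π (e.dec I) (e.ctx I)).1 _
    rw [hdev (e.dec I) (e.owner_dec I ▸ hI)]

end InfoEmbedding

/-! ### Convergence, and transfer of trembling hand perfection -/

theorem EFG.tendsto_strategy_iff {n : ℕ} {G : EFG n} {s : ℕ → G.Strategy} {σ : G.Strategy} :
    Tendsto s atTop (𝓝 σ) ↔ ∀ I t, Tendsto (fun k => (s k I).1 t) atTop (𝓝 ((σ I).1 t)) := by
  simp only [tendsto_pi_nhds, tendsto_subtype_rng]

theorem MAIM.tendsto_policy_iff {n : ℕ} {M : MAIM n} {p : ℕ → M.Policy} {π : M.Policy} :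
    Tendsto p atTop (𝓝 π) ↔
      ∀ d c v, Tendsto (fun k => (p k d c).1 v) atTop (𝓝 ((π d c).1 v)) := by
  simp only [tendsto_pi_nhds, tendsto_subtype_rng]

theorem EFG.tendsto_norm_perturbation_iff {n : ℕ} {G : EFG n} {δ : ℕ → G.PerturbationVector} :
    Tendsto (fun k => ‖δ k‖) atTop (𝓝 0) ↔
      ∀ I t, Tendsto (fun k => δ k I t) atTop (𝓝 0) := by
  rw [← tendsto_zero_iff_norm_tendsto_zero]
  simp only [tendsto_pi_nhds, Pi.zero_apply]

theorem MAIM.tendsto_norm_perturbation_iff {n : ℕ} {M : MAIM n} {δ : ℕ → M.PerturbationVector} :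
    Tendsto (fun k => ‖δ k‖) atTop (𝓝 0) ↔
      ∀ d c v, Tendsto (fun k => δ k d c v) atTop (𝓝 0) := by
  rw [← tendsto_zero_iff_norm_tendsto_zero]
  simp only [tendsto_pi_nhds, Pi.zero_apply]

/-- The mixture of a distribution with the uniform distribution. -/
def mixUniform {α : Type*} [Fintype α] [Nonempty α] (ε : ℝ) (h0 : 0 ≤ ε) (h1 : ε ≤ 1)
    (q : stdSimplex ℝ α) : stdSimplex ℝ α :=
  ⟨fun v => (1 - ε) * q.1 v + ε / Fintype.card α,
    fun v => add_nonneg (mul_nonneg (sub_nonneg.2 h1) (q.2.1 v)) (by positivity), by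
      have : (Fintype.card α : ℝ) ≠ 0 := Nat.cast_ne_zero.2 Fintype.card_ne_zero
      rw [Finset.sum_add_distrib, ← Finset.mul_sum, q.2.2]
      simp only [Finset.sum_const, Finset.card_univ, nsmul_eq_mul]
      field_simp
      ring⟩

namespace InfoEmbedding

variable {n : ℕ} {G : EFG n} {M : MAIM n} (e : InfoEmbedding G M)

/-- Restriction only selects and relabels coordinates, so positivity, sums, limits and equilibria
all survive it. -/
theorem isTHPE_restrict (he : e.PreservesUtility) {π : M.Policy} (h : M.IsTHPE π) :
    G.IsTHPE (e.restrict π) := by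
  obtain ⟨δ, hδ, hδ0, p, hp, hpπ⟩ := h
  refine ⟨fun k => e.restrictPerturbation (δ k), fun k => e.isPerturbation_restrict (hδ k), ?_,
    fun k => e.restrict (p k), fun k => ((e.isPerturbedNE_iff he _ _).1 (hp k)).1, ?_⟩
  · rw [EFG.tendsto_norm_perturbation_iff]
    rw [MAIM.tendsto_norm_perturbation_iff] at hδ0
    exact fun I t => hδ0 _ _ _
  · rw [EFG.tendsto_strategy_iff]
    rw [MAIM.tendsto_policy_iff] at hpπ
    exact fun I t => hpπ _ _ _

/-- Off the embedding nothing is at stake, so equilibrium does not constrain behaviour there. It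
only has to respect some perturbation tending to zero and to converge to `π`. -/
theorem isTHPE_of_restrict (he : e.PreservesUtility) {π : M.Policy}
    (h : G.IsTHPE (e.restrict π)) : M.IsTHPE π := by
  obtain ⟨δ, hδ, hδ0, s, hs, hsσ⟩ := h
  -- In a model each entry must be below one, whereas in a game a single available decision may have
  -- entry one. Dropping finitely many terms removes such entries.
  obtain ⟨N, hN⟩ : ∃ N, ∀ k, ‖δ (k + N)‖ < 1 := by
    obtain ⟨N, hN⟩ := eventually_atTop.1 (hδ0.eventually_lt_const one_pos)
    exact ⟨N, fun k => hN _ (Nat.le_add_left _ _)⟩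
  have hlt : ∀ k I t, δ (k + N) I t < 1 := fun k I t =>
    ((le_abs_self _).trans ((norm_le_pi_norm (δ (k + N) I) t).trans
      (norm_le_pi_norm (δ (k + N)) I))).trans_lt (hN k)
  -- The `2` keeps `ε 0` below one, as is needed where the domain has a single element.
  let ε : ℕ → ℝ := fun k => 1 / ((k : ℝ) + 2)
  have hε0 : ∀ k, 0 < ε k := fun k => by positivity
  have hε1 : ∀ k, ε k < 1 := fun k => by
    rw [div_lt_one (by positivity)]
    have : (0 : ℝ) ≤ k := k.cast_nonneg
    linarith
  have hεlim : Tendsto ε atTop (𝓝 0) :=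
    tendsto_const_nhds.div_atTop (tendsto_atTop_add_const_right _ _ tendsto_natCast_atTop_atTop)
  choose Δ hΔ hΔoff using fun k => e.exists_extension
    (β := fun d _ => M.dom (.inr d) → ℝ) (fun I v => δ (k + N) I ((e.act I).symm v))
    (fun d _ _ => ε k / Fintype.card (M.dom (.inr d)))
  -- The uniform part of the mixture is exactly the lower bound `Δ` off the embedding.
  choose p hp hpres hpoff using fun k => e.exists_policy (s (k + N))
    (fun d c => mixUniform (ε k) (hε0 k).le (hε1 k).le (π d c))
  have hcard : ∀ d : M.D, (1 : ℝ) ≤ Fintype.card (M.dom (.inr d)) := fun d =>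
    Nat.one_le_cast.2 Fintype.card_pos
  have hres : ∀ k, e.restrictPerturbation (Δ k) = δ (k + N) := by
    intro k
    funext I t
    change Δ k _ _ _ = _
    rw [hΔ]
    exact congrArg (δ (k + N) I) ((e.act I).symm_apply_apply t)
  refine ⟨Δ, fun k => ⟨?_, ?_⟩, ?_, p, fun k => ?_, ?_⟩
  · refine e.forall_context (fun I v => ?_) (fun d c hoff v => ?_)
    · rw [hΔ]
      exact ⟨(hδ _).1 _ _, hlt _ _ _⟩
    · rw [hΔoff k d c hoff]
      refine ⟨div_pos (hε0 k) (one_pos.trans_le (hcard d)), ?_⟩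
      exact (div_le_self (hε0 k).le (hcard d)).trans_lt (hε1 k)
  · refine e.forall_context (fun I => ?_) (fun d c hoff => ?_)
    · rw [hΔ, Equiv.sum_comp (e.act I).symm]
      exact (hδ _).2 I
    · rw [hΔoff k d c hoff]
      simp only [Finset.sum_const, Finset.card_univ, nsmul_eq_mul]
      rw [mul_div_cancel₀ _ (one_pos.trans_le (hcard d)).ne']
      exact (hε1 k).le
  · rw [MAIM.tendsto_norm_perturbation_iff]
    rw [EFG.tendsto_norm_perturbation_iff] at hδ0
    refine e.forall_context (fun I v => ?_) (fun d c hoff v => ?_)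
    · simp only [hΔ]
      exact (tendsto_add_atTop_iff_nat N).2 (hδ0 _ _)
    · simp only [hΔoff _ d c hoff]
      simpa using hεlim.div_const (Fintype.card (M.dom (.inr d)) : ℝ)
  · rw [e.isPerturbedNE_iff he, hres, hpres]
    refine ⟨hs _, fun d c hoff v => ?_⟩
    rw [hΔoff k d c hoff, hpoff k d c hoff]
    exact le_add_of_nonneg_left (mul_nonneg (sub_nonneg.2 (hε1 k).le) ((π d c).2.1 v))
  · rw [MAIM.tendsto_policy_iff]
    rw [EFG.tendsto_strategy_iff] at hsσ
    refine e.forall_context (fun I v => ?_) (fun d c hoff v => ?_)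
    · simp only [hp]
      rw [← e.push_restrict π]
      exact (tendsto_add_atTop_iff_nat N).2 (hsσ _ _)
    · simp only [hpoff _ d c hoff]
      have h1 := ((tendsto_const_nhds (x := (1 : ℝ))).sub hεlim).mul_const ((π d c).1 v)
      have h2 := h1.add (hεlim.div_const (Fintype.card (M.dom (.inr d)) : ℝ))
      simpa [mixUniform] using h2

/-- From right to left a single policy profile in the fibre suffices; it exists because restriction
is surjective. -/
theorem isTHPE_iff_image (he : e.PreservesUtility) (σ : G.Strategy) :
    G.IsTHPE σ ↔ ∀ π ∈ (e.naturalMapping he).image σ, M.IsTHPE π := by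
  simp only [e.mem_image_iff he]
  constructor
  · rintro h π rfl
    exact e.isTHPE_of_restrict he h
  · intro h
    obtain ⟨π, rfl⟩ := e.restrict_surjective σ
    exact e.isTHPE_restrict he (h π rfl)

end InfoEmbedding

/-! ### Sums of products of normalized kernels along an acyclic graph -/

section KernelProducts

variable {ι : Type*} [Fintype ι] [DecidableEq ι] {dom : ι → Type*} [∀ i, Fintype (dom i)]

/-- Double counting: every assignment arises from as many pairs `(a, t)` as there are values for its
overwritten coordinate `i`. -/
theorem sum_sum_update (i : ι) (f : (∀ j, dom j) → ℝ) :
    ∑ a : ∀ j, dom j, ∑ t : dom i, f (Function.update a i t) =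
      Fintype.card (dom i) * ∑ a, f a := by
  have hup : ∀ (t t' : dom i) (r : ∀ j : {j // j ≠ i}, dom j),
      Function.update ((Equiv.piSplitAt i dom).symm (t', r)) i t =
        (Equiv.piSplitAt i dom).symm (t, r) := by
    intro t t' r
    funext j
    by_cases hj : j = i
    · subst hj
      simp [Equiv.piSplitAt]
    · simp [Equiv.piSplitAt, hj]
  rw [← Equiv.sum_comp (Equiv.piSplitAt i dom).symm,
    ← Equiv.sum_comp (Equiv.piSplitAt i dom).symm]
  simp only [Fintype.sum_prod_type, hup]
  simp only [Finset.sum_const, Finset.card_univ, nsmul_eq_mul]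
  rw [Finset.sum_comm]

/-- A normalized factor in a coordinate on which no other factor depends can be replaced by the
uniform one. -/
theorem sum_mul_eq_sum_mul_uniform [∀ i, Nonempty (dom i)] (i : ι) (F h : (∀ j, dom j) → ℝ)
    (hF : ∀ a t, F (Function.update a i t) = F a)
    (hh : ∀ a, ∑ t, h (Function.update a i t) = 1) :
    ∑ a, F a * h a = ∑ a, F a * (1 / Fintype.card (dom i)) := by
  have hc : (Fintype.card (dom i) : ℝ) ≠ 0 := Nat.cast_ne_zero.2 Fintype.card_ne_zero
  -- Resampling coordinate `i` leaves `F` alone and sums `h` to one.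
  have h1 := sum_sum_update i fun a => F a * h a
  simp only [hF, ← Finset.mul_sum, hh, mul_one] at h1
  rw [← Finset.sum_mul, h1]
  field_simp

/-- In a product of normalized kernels along an acyclic graph, the kernels of a set of nodes that
is closed under descendants can be replaced by uniform ones. -/
theorem sum_mul_prod_kernel [∀ i, Nonempty (dom i)] {E : ι → ι → Prop}
    (hE : ∀ i, ¬ TransGen E i i) (q : ι → (∀ j, dom j) → ℝ)
    (hq : ∀ i a, ∑ t, q i (Function.update a i t) = 1)
    (hdep : ∀ i j, i ≠ j → ¬ E j i → ∀ a t, q i (Function.update a j t) = q i a) (W : Finset ι)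
    (hW : ∀ i ∈ W, ∀ j, E i j → j ∈ W) (g : (∀ j, dom j) → ℝ)
    (hg : ∀ i ∈ W, ∀ a t, g (Function.update a i t) = g a) :
    ∑ a, g a * ∏ i, q i a =
      ∑ a, g a * ∏ i, if i ∈ W then 1 / (Fintype.card (dom i) : ℝ) else q i a := by
  induction hn : W.card generalizing W with
  | zero =>
    rw [Finset.card_eq_zero] at hn
    simp [hn]
  | succ m ih =>
    have hwf : WellFounded (TransGen E) := by
      have : IsTrans ι (TransGen E) := ⟨fun _ _ _ h h' => h.trans h'⟩
      have : Std.Irrefl (TransGen E) := ⟨hE⟩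
      exact Finite.wellFounded_of_trans_of_irrefl _
    -- No element of `W` is an ancestor of `v`, so `W` without `v` is still closed under children,
    -- and `v` can be treated after all the others.
    obtain ⟨v, hv, hmin⟩ := hwf.has_min (W : Set ι)
      (Finset.card_pos.1 (by omega) : W.Nonempty)
    have hv' : v ∈ W := hv
    rw [ih (W.erase v) ?_ ?_ (by rw [Finset.card_erase_of_mem hv', hn]; rfl)]
    · have h1 : ∀ a, (∏ i, if i ∈ W.erase v then 1 / (Fintype.card (dom i) : ℝ) else q i a) =
          (∏ i ∈ Finset.univ.erase v,
            if i ∈ W then 1 / (Fintype.card (dom i) : ℝ) else q i a) * q v a := by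
        intro a
        rw [← Finset.prod_erase_mul _ _ (Finset.mem_univ v)]
        simp only [Finset.mem_erase, ne_eq, not_true_eq_false, false_and, if_false]
        congr 1
        refine Finset.prod_congr rfl fun i hi => ?_
        simp [(Finset.mem_erase.1 hi).1]
      have h2 : ∀ a, (∏ i, if i ∈ W then 1 / (Fintype.card (dom i) : ℝ) else q i a) =
          (∏ i ∈ Finset.univ.erase v,
            if i ∈ W then 1 / (Fintype.card (dom i) : ℝ) else q i a) *
              (1 / Fintype.card (dom v)) := by
        intro a
        rw [← Finset.prod_erase_mul _ _ (Finset.mem_univ v), if_pos hv']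
      simp only [h1, h2, ← mul_assoc]
      refine sum_mul_eq_sum_mul_uniform v _ _ (fun a t => ?_) (hq v)
      rw [hg v hv']
      congr 1
      refine Finset.prod_congr rfl fun i hi => ?_
      -- Factors in `W` are uniform by now, and a node outside `W` is not a child of `v`, because
      -- `W` contains the children of `v`.
      split_ifs with hiW
      · rfl
      · exact hdep i v (Finset.mem_erase.1 hi).1 (fun h => hiW (hW v hv' i h)) a t
    · intro i hi j hij
      refine Finset.mem_erase.2 ⟨?_, hW i (Finset.mem_of_mem_erase hi) j hij⟩
      rintro rfl
      exact hmin i (Finset.mem_of_mem_erase hi) (.single hij)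
    · exact fun i hi => hg i (Finset.mem_of_mem_erase hi)

/-- The case where all kernels become uniform: what remains is the total mass of the uniform
distribution. -/
theorem sum_prod_kernel [∀ i, Nonempty (dom i)] {E : ι → ι → Prop}
    (hE : ∀ i, ¬ TransGen E i i) (q : ι → (∀ j, dom j) → ℝ)
    (hq : ∀ i a, ∑ t, q i (Function.update a i t) = 1)
    (hdep : ∀ i j, i ≠ j → ¬ E j i → ∀ a t, q i (Function.update a j t) = q i a) :
    ∑ a, ∏ i, q i a = 1 := by
  have h := sum_mul_prod_kernel hE q hq hdep Finset.univ (fun _ _ _ _ => Finset.mem_univ _)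
    (fun _ => 1) (fun _ _ _ _ => rfl)
  simp only [one_mul, Finset.mem_univ, if_true] at h
  rw [h, Finset.sum_const, Finset.card_univ, Fintype.card_pi, nsmul_eq_mul, Nat.cast_prod,
    ← Finset.prod_mul_distrib]
  refine Finset.prod_eq_one fun i _ => mul_one_div_cancel ?_
  exact Nat.cast_ne_zero.2 Fintype.card_ne_zero

end KernelProducts

/-! ### Path probabilities in a game tree -/

namespace EFG

variable {n : ℕ} (G : EFG n)

theorem not_transGen_self (u : G.V) : ¬ TransGen G.E u u := by
  refine G.E_head_induction (v := u) (p := fun u => ¬ TransGen G.E u u) fun u ih h => ?_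
  obtain ⟨z, hz, hzu⟩ := TransGen.tail'_iff.1 h
  exact ih z hzu (.head' hzu hz)

theorem reflTransGen_child_iff {u w : G.V} (hE : G.E u w) (x : G.V) :
    ReflTransGen G.E x w ↔ x = w ∨ ReflTransGen G.E x u := by
  constructor
  · intro h
    rcases h.cases_tail with rfl | ⟨z, hz, hzw⟩
    · exact Or.inl rfl
    · exact Or.inr (G.parent_unique _ _ _ hzw hE ▸ hz)
  · rintro (rfl | h)
    · exact .refl
    · exact h.tail hE

theorem pathProb_root (σ : G.Strategy) : G.pathProb σ G.root = 1 := by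
  have : IsEmpty {e : G.V × G.V // G.E e.1 e.2 ∧ ReflTransGen G.E e.2 G.root} := by
    refine ⟨fun ⟨e, he, hr⟩ => ?_⟩
    rcases hr.cases_tail with h | ⟨z, -, hz⟩
    · exact G.no_parent_root e.1 (by rw [h]; exact he)
    · exact G.no_parent_root z hz
  exact Fintype.prod_empty _

theorem pathProb_child (σ : G.Strategy) (u : G.V) (w : {w // G.E u w}) :
    G.pathProb σ w.1 = G.pathProb σ u * G.stepProb σ u w := by
  -- Extending the factors to all pairs of nodes lets the products for `u` and `w` range over
  -- finsets of one type; the default `1` is never used.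
  let g : G.V × G.V → ℝ := fun e => if h : G.E e.1 e.2 then G.stepProb σ e.1 ⟨e.2, h⟩ else 1
  have hg : ∀ (u : G.V) (w : {w // G.E u w}), g (u, w.1) = G.stepProb σ u w := fun u w => by
    simp only [g]
    exact dif_pos w.2
  have key : ∀ v, G.pathProb σ v =
      ∏ e : G.V × G.V with G.E e.1 e.2 ∧ ReflTransGen G.E e.2 v, g e := by
    intro v
    rw [Finset.prod_subtype (p := fun e => G.E e.1 e.2 ∧ ReflTransGen G.E e.2 v) _ (by simp)]
    exact Finset.prod_congr rfl fun e _ => (hg _ ⟨_, e.2.1⟩).symm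
  rw [key, key, ← hg, mul_comm,
    ← Finset.prod_insert]
  · congr 1
    ext ⟨x, y⟩
    simp only [Finset.mem_filter, Finset.mem_univ, true_and, Finset.mem_insert, Prod.mk.injEq,
      G.reflTransGen_child_iff w.2]
    constructor
    · rintro ⟨h, rfl | h'⟩
      · exact Or.inl ⟨G.parent_unique _ _ _ h w.2, rfl⟩
      · exact Or.inr ⟨h, h'⟩
    · rintro (⟨rfl, rfl⟩ | h)
      · exact ⟨w.2, Or.inl rfl⟩
      · exact ⟨h.1, Or.inr h.2⟩
  · simp only [Finset.mem_filter, Finset.mem_univ, true_and, not_and]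
    exact fun h h' => G.not_transGen_self u (.head' h h')

theorem stepProb_chance (σ : G.Strategy) {u : G.V} (h : G.kind u = .chance)
    (w : {w // G.E u w}) : G.stepProb σ u w = (G.P h).1 w := by
  unfold stepProb
  split
  · next h' => rw [h] at h'; cases h'
  · rfl
  · next h' => rw [h] at h'; cases h'

theorem stepProb_decision (σ : G.Strategy) {u : G.V} {I : G.Info} (h : G.kind u = .decision I)
    (w : {w // G.E u w}) : G.stepProb σ u w = (σ I).1 (G.label h w) := by
  unfold stepProb
  split
  · next h' => rw [h] at h'; cases h'
  · next h' => rw [h] at h'; cases h'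
  · next J h' =>
    have hJ : J = I := by rw [h] at h'; cases h'; rfl
    subst hJ
    rfl

end EFG

/-! ### The joint distribution of a model and its factors -/

theorem MAIM.expectedUtility_eq {n : ℕ} (M : MAIM n) (i : Fin n) (π : M.Policy) :
    M.expectedUtility i π =
      ∑ a, M.prob π a * ∑ j : M.U with M.ownerU j = i, M.utilVal j a := by
  simp only [Finset.mul_sum]
  rw [Finset.sum_comm]
  refine Finset.sum_congr rfl fun j _ => ?_
  rw [← Finset.sum_fiberwise_of_maps_to (s := Finset.univ) (t := M.utilDom j)
    (g := M.utilVal j) fun a _ => Finset.mem_image_of_mem _ (Finset.mem_univ _)]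
  refine Finset.sum_congr rfl fun u _ => ?_
  rw [utilProb, Finset.mul_sum]
  refine Finset.sum_congr rfl fun a ha => ?_
  rw [(Finset.mem_filter.1 ha).2, mul_comm]

namespace MAIM

variable {n : ℕ} (M : MAIM n)

theorem parents_update (v u : M.Node) (h : ¬ M.E u v) (a : M.Assignment) (t : M.dom u) :
    M.parents (Function.update a u t) v = M.parents a v := by
  funext y
  refine Function.update_of_ne ?_ _ _
  rintro rfl
  exact h y.2

/-- The factor of the joint distribution that belongs to a chance or decision node. -/
def kernel (π : M.Policy) : M.Node → M.Assignment → ℝ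
  | .inl x, a => (M.cpd x (M.parents a (.inl x))).1 (a (.inl x))
  | .inr d, a => (π d (M.parents a (.inr d))).1 (a (.inr d))

theorem prod_kernel (π : M.Policy) (a : M.Assignment) :
    ∏ v, M.kernel π v a = M.prob π a :=
  Fintype.prod_sum_type _

theorem not_E_self (v : M.Node) : ¬ M.E v v := fun h => M.acyclic v (.single h)

theorem sum_kernel (π : M.Policy) (v : M.Node) (a : M.Assignment) :
    ∑ t, M.kernel π v (Function.update a v t) = 1 := by
  cases v with
  | inl x =>
    simp only [kernel, M.parents_update _ _ (M.not_E_self _), Function.update_self]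
    exact (M.cpd x _).2.2
  | inr d =>
    simp only [kernel, M.parents_update _ _ (M.not_E_self _), Function.update_self]
    exact (π d _).2.2

theorem kernel_update (π : M.Policy) (v u : M.Node) (hne : v ≠ u) (hE : ¬ M.E u v)
    (a : M.Assignment) (t : M.dom u) :
    M.kernel π v (Function.update a u t) = M.kernel π v a := by
  cases v <;> simp only [kernel, M.parents_update _ _ hE, Function.update_of_ne hne]

end MAIM

/-! ### Weights as probabilities under the uniform policy profile -/

namespace MAIM

variable {n : ℕ} (M : MAIM n)

/-- The policy profile that plays uniformly everywhere. -/
def uniformPolicy : M.Policy := fun d _ =>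
  ⟨fun _ => 1 / Fintype.card (M.dom (.inr d)), fun _ => by positivity, by
    rw [Finset.sum_const, Finset.card_univ, nsmul_eq_mul]
    exact mul_one_div_cancel (Nat.cast_ne_zero.2 Fintype.card_ne_zero)⟩

theorem prod_kernel_uniformPolicy (a : M.Assignment) :
    ∏ v, M.kernel M.uniformPolicy v a =
      M.weight a * ∏ d : M.D, (1 / Fintype.card (M.dom (.inr d)) : ℝ) :=
  M.prod_kernel _ a

theorem prod_inv_card_mul_prod_card (s : Finset M.D) :
    (∏ d ∈ s, (1 / Fintype.card (M.dom (.inr d)) : ℝ)) *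
      ∏ d ∈ s, (Fintype.card (M.dom (.inr d)) : ℝ) = 1 := by
  rw [← Finset.prod_mul_distrib]
  exact Finset.prod_eq_one fun d _ =>
    one_div_mul_cancel (Nat.cast_ne_zero.2 Fintype.card_ne_zero)

/-- The weight lacks the factors of the decision nodes. Supplying uniform ones gives a probability
distribution and divides the sum by the number of joint decisions. -/
theorem sum_weight : ∑ a, M.weight a = ∏ d : M.D, (Fintype.card (M.dom (.inr d)) : ℝ) := by
  have h := sum_prod_kernel M.acyclic (M.kernel M.uniformPolicy) (M.sum_kernel _)
    (M.kernel_update _)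
  simp only [prod_kernel_uniformPolicy] at h
  rw [← Finset.sum_mul] at h
  rw [← mul_one (∑ a, M.weight a), ← M.prod_inv_card_mul_prod_card Finset.univ, ← mul_assoc, h,
    one_mul]

/-- The values of a decision node are equally likely under the product of the CPDs, given values
of other nodes that are not among its descendants. -/
theorem sum_indicator_weight (d : M.D) (g : M.Assignment → ℝ)
    (hg : ∀ v, ReflTransGen M.E (.inr d) v → ∀ a t, g (Function.update a v t) = g a)
    (v : M.dom (.inr d)) :
    ∑ a, g a * M.weight a =
      Fintype.card (M.dom (.inr d)) * ∑ a, (if a (.inr d) = v then g a else 0) * M.weight a := by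
  -- Strict descendants only: the indicator of the value of `d` must not depend on the nodes in `W`.
  let W : Finset M.Node := Finset.univ.filter fun u => TransGen M.E (.inr d) u
  have hmemW : ∀ u, u ∈ W ↔ TransGen M.E (.inr d) u := fun u => by simp [W]
  have hdW : (Sum.inr d : M.Node) ∉ W := fun h => M.acyclic _ ((hmemW _).1 h)
  have hW : ∀ i ∈ W, ∀ j, M.E i j → j ∈ W := fun i hi j hij =>
    (hmemW j).2 (((hmemW i).1 hi).tail hij)
  have hc : (∏ d : M.D, (1 / Fintype.card (M.dom (.inr d)) : ℝ)) ≠ 0 :=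
    left_ne_zero_of_mul_eq_one (M.prod_inv_card_mul_prod_card Finset.univ)
  have hcd : (Fintype.card (M.dom (.inr d)) : ℝ) ≠ 0 := Nat.cast_ne_zero.2 Fintype.card_ne_zero
  have hind : ∀ (u : M.Node) (_ : u ≠ .inr d) (a : M.Assignment) (t : M.dom u),
      Function.update a u t (.inr d) = a (.inr d) := fun u hu a t =>
    Function.update_of_ne hu.symm _ _
  have h1 := sum_mul_prod_kernel M.acyclic (M.kernel M.uniformPolicy) (M.sum_kernel _)
    (M.kernel_update _) W hW g fun i hi => hg i ((hmemW i).1 hi).to_reflTransGen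
  have h2 := sum_mul_prod_kernel M.acyclic (M.kernel M.uniformPolicy) (M.sum_kernel _)
    (M.kernel_update _) W hW (fun a => if a (.inr d) = v then g a else 0) fun i hi a t => by
      rw [hind i (fun h => hdW (h ▸ hi)), hg i ((hmemW i).1 hi).to_reflTransGen]
  simp only [prod_kernel_uniformPolicy, ← mul_assoc] at h1 h2
  rw [← Finset.sum_mul] at h1 h2
  apply mul_right_cancel₀ hc
  rw [h1, mul_assoc, h2]
  -- With the descendants of `d` made uniform, no factor of `F` depends on the value of `d`. The
  -- indicator is then a normalized factor and may be replaced by the uniform one.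
  let F : M.Assignment → ℝ := fun a => g a *
    ∏ i, if i ∈ W then 1 / (Fintype.card (M.dom i) : ℝ) else M.kernel M.uniformPolicy i a
  have h3 := sum_mul_eq_sum_mul_uniform (dom := M.dom) (.inr d) F
    (fun a => if a (.inr d) = v then 1 else 0)
    (fun a t => by
      simp only [F]
      rw [hg _ .refl]
      congr 1
      refine Finset.prod_congr rfl fun i _ => ?_
      split_ifs with hi
      · rfl
      -- The factor of `d` itself is uniform under `uniformPolicy`, hence constant in the value of
      -- `d`.
      · by_cases hid : i = .inr d
        · subst hid
          rfl
        · exact M.kernel_update _ _ _ hid (fun h => hi ((hmemW _).2 (.single h))) _ _)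
    (fun a => by simp [Function.update_self])
  have h4 : ∀ a, (if a (.inr d) = v then g a else 0) *
      (∏ i, if i ∈ W then 1 / (Fintype.card (M.dom i) : ℝ) else M.kernel M.uniformPolicy i a) =
      F a * (if a (.inr d) = v then 1 else 0) := by
    intro a
    simp only [F]
    split_ifs <;> simp
  simp only [h4]
  rw [h3, ← Finset.sum_mul]
  field_simp
  rfl

/-! ### From models to games: path probabilities and utilities -/

namespace Splitting

variable {M} (T : M.Splitting)

/-- The position of a decision node in the splitting order. -/
def pos (d : M.D) : ℕ := T.ord ⟨.inr d, T.dec_mem d⟩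

theorem pos_lt (d : M.D) : T.pos d < T.S.card := (T.ord _).2

theorem restrict_eq_iff (k : ℕ) (a b : M.Assignment) :
    T.restrict k a = T.restrict k b ↔ ∀ s : T.S, (T.ord s : ℕ) < k → a s.1 = b s.1 :=
  ⟨fun h s hs => congrFun h ⟨s, hs⟩, fun h => funext fun s => h s.1 s.2⟩

theorem restrict_succ_eq_iff (d : M.D) (a b : M.Assignment) :
    T.restrict (T.pos d + 1) a = T.restrict (T.pos d + 1) b ↔
      T.restrict (T.pos d) a = T.restrict (T.pos d) b ∧ a (.inr d) = b (.inr d) := by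
  simp only [restrict_eq_iff]
  constructor
  · exact fun h => ⟨fun s hs => h s (by omega), h ⟨.inr d, T.dec_mem d⟩ (Nat.lt_succ_self _)⟩
  · rintro ⟨h, hd⟩ s hs
    rcases Nat.lt_succ_iff_lt_or_eq.1 hs with hs | hs
    · exact h s hs
    · have : s = ⟨.inr d, T.dec_mem d⟩ := T.ord.injective (Fin.ext hs)
      subst this
      exact hd

theorem mass_eq_sum_ite {k : ℕ} (p : T.Prefix k) :
    T.mass p = ∑ a, (if T.restrict k a = p then 1 else 0) * M.weight a := by
  rw [mass, Finset.sum_filter]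
  exact Finset.sum_congr rfl fun a _ => by split_ifs <;> simp

/-- The splitting nodes before `d` include neither `d` nor a descendant of it, so the mass of their
instantiation is shared equally by the values of `d`. -/
theorem mass_decision (d : M.D) (a : M.Assignment) :
    T.mass (T.restrict (T.pos d) a) =
      Fintype.card (M.dom (.inr d)) * T.mass (T.restrict (T.pos d + 1) a) := by
  rw [mass_eq_sum_ite, mass_eq_sum_ite, M.sum_indicator_weight d _ _ (a (.inr d))]
  · congr 1
    refine Finset.sum_congr rfl fun b _ => ?_
    congr 1
    simp only [T.restrict_succ_eq_iff]
    split_ifs <;> tauto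
  · intro v hv b t
    have : T.restrict (T.pos d) (Function.update b v t) = T.restrict (T.pos d) b := by
      rw [restrict_eq_iff]
      intro s hs
      refine Function.update_of_ne ?_ _ _
      rintro rfl
      rcases reflTransGen_iff_eq_or_transGen.1 hv with h | h
      · have : s = ⟨.inr d, T.dec_mem d⟩ := Subtype.ext h
        subst this
        exact lt_irrefl _ hs
      · have h1 := T.topological ⟨.inr d, T.dec_mem d⟩ s h
        exact lt_asymm hs h1
    simp only [this]

/-- Information sets are decision nodes with a decision context. -/
def infoEmbedding : InfoEmbedding T.toEFG M where
  dec := fun I => I.1.1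
  ctx := fun I => I.1.2
  act := fun _ => Equiv.refl _
  inj := fun _ _ h => Subtype.ext h
  owner_dec := fun _ => rfl

/-- The mass counts every value of an undecided decision node with weight one; the cardinalities on
the left compensate for this. A chance step multiplies both sides by a ratio of masses. A decision
step trades one cardinality for one policy factor, by `mass_decision`. -/
theorem pathProb_mkNode (π : M.Policy) (a : M.Assignment) (ha : 0 < M.weight a) (k : ℕ)
    (hk : k ≤ T.S.card) :
    T.toEFG.pathProb (T.infoEmbedding.restrict π) (T.mkNode k hk a ha) *
        ∏ d : M.D with k ≤ T.pos d, (Fintype.card (M.dom (.inr d)) : ℝ) =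
      T.mass (T.restrict k a) *
        ∏ d : M.D with T.pos d < k, M.kernel π (.inr d) a := by
  induction k with
  | zero =>
    have hroot : T.mkNode 0 hk a ha = T.toEFG.root :=
      T.ext_node rfl fun s hs _ => absurd hs (Nat.not_lt_zero _)
    rw [hroot, EFG.pathProb_root, mass_eq_sum_ite]
    have : ∀ b, T.restrict 0 b = T.restrict 0 a := fun b =>
      (T.restrict_eq_iff 0 b a).2 fun s hs => absurd hs (Nat.not_lt_zero _)
    simp [this, M.sum_weight]
  | succ k ih =>
    have hk' : k ≤ T.S.card := by omega
    let u : T.TreeNode := T.mkNode k hk' a ha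
    let w : {w // T.toEFG.E u w} :=
      ⟨T.mkNode (k + 1) hk a ha, T.child_mkNode hk rfl a ha rfl⟩
    have hlt : T.depth u < T.S.card := hk
    have hpos : ∀ d, T.pos d = k ↔ T.next u hlt = .inr d := by
      intro d
      constructor
      · intro h
        have h1 : T.ord ⟨.inr d, T.dec_mem d⟩ = ⟨T.depth u, hlt⟩ := Fin.ext h
        rw [next, ← h1, Equiv.symm_apply_apply]
      · exact fun h => T.ord_next u hlt ⟨.inr d, T.dec_mem d⟩ h.symm
    have hmass : 0 < T.mass (T.restrict k a) := (T.mass_pos_iff _).2 ⟨a, rfl, ha⟩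
    specialize ih hk'
    have hchild := T.toEFG.pathProb_child (T.infoEmbedding.restrict π) u w
    change T.toEFG.pathProb (T.infoEmbedding.restrict π) (T.mkNode (k + 1) hk a ha) = _ at hchild
    rw [hchild]
    change T.toEFG.pathProb (T.infoEmbedding.restrict π) u * _ = _ at ih
    rcases hnext : T.next u hlt with x | d
    · have hkind : T.toEFG.kind u = .chance := by
        change T.nodeKind u = _
        unfold nodeKind
        rw [dif_pos hlt]
        split
        · rfl
        · next d hd => rw [hnext] at hd; cases hd
      have hne : ∀ d, T.pos d ≠ k := fun d h => by
        have := (hpos d).1 h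
        rw [hnext] at this
        cases this
      have h1 : ∀ d, k + 1 ≤ T.pos d ↔ k ≤ T.pos d := fun d => by have := hne d; omega
      have h2 : ∀ d, T.pos d < k + 1 ↔ T.pos d < k := fun d => by have := hne d; omega
      simp only [h1, h2]
      rw [T.toEFG.stepProb_chance _ hkind]
      change _ * (T.mass (T.restrict (k + 1) a) / T.mass (T.restrict k a)) * _ = _
      rw [mul_right_comm, ih]
      field_simp
    · have hd : T.pos d = k := (hpos d).2 hnext
      subst hd
      -- The context recorded at `u` is that of `a` by definition, which is what the last `rfl`
      -- says.
      let I : T.InfoSet := ⟨⟨d, M.parents a (.inr d)⟩, u, hlt, hnext, rfl⟩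
      have hkind : T.toEFG.kind u = .decision I :=
        (T.nodeKind_decision_iff u I).2 ⟨hlt, hnext, rfl⟩
      have huniq : ∀ d', T.pos d' = T.pos d → d' = d := fun d' h => by
        have := (hpos d').1 h
        rw [hnext] at this
        exact (Sum.inr_injective this).symm
      have h1 : (Finset.univ.filter fun d' => T.pos d ≤ T.pos d') =
          insert d (Finset.univ.filter fun d' => T.pos d + 1 ≤ T.pos d') := by
        ext d'
        simp only [Finset.mem_filter, Finset.mem_univ, true_and, Finset.mem_insert]
        constructor
        · intro h
          rcases h.eq_or_lt with h | h
          · exact Or.inl (huniq _ h.symm)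
          · exact Or.inr h
        · rintro (rfl | h)
          · exact le_rfl
          · omega
      have h2 : (Finset.univ.filter fun d' => T.pos d' < T.pos d + 1) =
          insert d (Finset.univ.filter fun d' => T.pos d' < T.pos d) := by
        ext d'
        simp only [Finset.mem_filter, Finset.mem_univ, true_and, Finset.mem_insert]
        constructor
        · intro h
          rcases Nat.lt_succ_iff_lt_or_eq.1 h with h | h
          · exact Or.inr h
          · exact Or.inl (huniq _ h)
        · rintro (rfl | h)
          · omega
          · omega
      rw [h1, Finset.prod_insert (by simp), T.mass_decision] at ih
      rw [h2, Finset.prod_insert (by simp), T.toEFG.stepProb_decision _ hkind]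
      change _ * M.kernel π (.inr d) a * _ = _
      have hcd : (Fintype.card (M.dom (.inr d)) : ℝ) ≠ 0 :=
        Nat.cast_ne_zero.2 Fintype.card_ne_zero
      apply mul_left_cancel₀ hcd
      linear_combination (M.kernel π (.inr d) a) * ih

/-- At a leaf every decision node has been decided, since all of them are splitting nodes; no
cardinalities are left. -/
theorem pathProb_leaf (π : M.Policy) (L : {v // T.toEFG.kind v = .leaf}) (a : M.Assignment)
    (ha : 0 < M.weight a) (h : T.restrict (T.depth L.1) a = T.lab L.1) :
    T.toEFG.pathProb (T.infoEmbedding.restrict π) L.1 =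
      T.mass (T.lab L.1) * ∏ d, M.kernel π (.inr d) a := by
  have hdepth : T.depth L.1 = T.S.card :=
    le_antisymm (T.depth_le L.1) (not_lt.1 ((T.nodeKind_leaf_iff L.1).1 L.2))
  have h1 := T.pathProb_mkNode π a ha _ (T.depth_le L.1)
  rw [← T.eq_mkNode L.1 a ha h, h, Finset.filter_false_of_mem, Finset.prod_empty, mul_one,
    Finset.filter_true_of_mem] at h1
  · exact h1
  · intro d _
    rw [hdepth]
    exact T.pos_lt d
  · intro d _
    rw [hdepth, not_le]
    exact T.pos_lt d

/-- A leaf contributes the sum of utility times probability over the instantiations that extend it,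
and each instantiation of positive weight extends exactly one leaf. -/
theorem preservesUtility : T.infoEmbedding.PreservesUtility := by
  intro π i
  let F : M.Assignment → ℝ := fun a => M.prob π a * ∑ j : M.U with M.ownerU j = i, M.utilVal j a
  -- An instantiation of weight zero may run into a removed branch and belong to no leaf; it
  -- contributes nothing.
  have hF : ∀ a, M.weight a = 0 → F a = 0 := fun a h => by simp [F, prob, h]
  have hleaf : ∀ L : {v // T.toEFG.kind v = .leaf},
      T.toEFG.pathProb (T.infoEmbedding.restrict π) L.1 * T.toEFG.U L i =
        ∑ a, if T.restrict (T.depth L.1) a = T.lab L.1 then F a else 0 := by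
    intro L
    change _ * (∑ j : M.U with M.ownerU j = i,
      (∑ a : M.Assignment with T.restrict (T.depth L.1) a = T.lab L.1,
        M.weight a * M.utilVal j a) / T.mass (T.lab L.1)) = _
    rw [← Finset.sum_div, Finset.sum_comm, mul_div_assoc', Finset.mul_sum,
      div_eq_iff (show T.mass (T.lab L.1) ≠ 0 from L.1.2.ne'), Finset.sum_mul, Finset.sum_filter]
    refine Finset.sum_congr rfl fun a _ => ?_
    by_cases h : T.restrict (T.depth L.1) a = T.lab L.1
    · rw [if_pos h, if_pos h]
      rcases (M.weight_nonneg a).eq_or_lt with ha | ha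
      · simp [hF a ha.symm, ← ha]
      -- The same path probability is expressed through each `a` at the leaf, so the policy factors
      -- may be taken from the `a` of the summand, and the mass cancels.
      · rw [T.pathProb_leaf π L a ha h, ← Finset.mul_sum]
        change _ = M.weight a * (∏ d, M.kernel π (.inr d) a) * _ * T.mass (T.lab L.1)
        ring
    · rw [if_neg h, if_neg h, zero_mul]
  rw [M.expectedUtility_eq, EFG.expectedUtility]
  simp only [hleaf]
  rw [Finset.sum_comm]
  refine Finset.sum_congr rfl fun a _ => ?_
  rcases (M.weight_nonneg a).eq_or_lt with ha | ha
  · change _ = F a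
    simp [hF a ha.symm]
  · let L : {v // T.toEFG.kind v = .leaf} :=
      ⟨T.mkNode T.S.card le_rfl a ha, (T.nodeKind_leaf_iff _).2 (lt_irrefl _)⟩
    rw [Finset.sum_eq_single L]
    · exact if_pos rfl
    · rintro ⟨L', hL'⟩ - hne
      refine if_neg fun h => hne (Subtype.ext ?_)
      have hdepth : T.depth L' = T.S.card :=
        le_antisymm (T.depth_le L') (not_lt.1 ((T.nodeKind_leaf_iff L').1 hL'))
      refine T.ext_node hdepth fun s hs _ => ?_
      exact (congrFun h ⟨s, hs⟩).symm
    · simp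

end Splitting

end MAIM

/-! ### From games to models: labels along paths -/

namespace EFG

variable {n : ℕ} {G : EFG n}

namespace Grouping

variable (J : G.Grouping)

theorem edgeLabel_decision {u : G.V} {I : G.Info} (h : G.kind u = .decision I)
    (w : {w // G.E u w}) : J.edgeLabel u w = ⟨.inr (J.dvar I), J.dlabel I (G.label h w)⟩ := by
  unfold edgeLabel
  split
  · next h' => rw [h] at h'; cases h'
  · next h' => rw [h] at h'; cases h'
  · next I' h' =>
    have hI : I' = I := by rw [h] at h'; cases h'; rfl
    subst hI
    rfl

theorem path_root : J.path G.root = ∅ := by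
  refine Set.eq_empty_of_forall_notMem ?_
  rintro p ⟨u, w, hr, -⟩
  rcases hr.cases_tail with h | ⟨z, -, hz⟩
  · exact G.no_parent_root u (by rw [h]; exact w.2)
  · exact G.no_parent_root z hz

theorem path_child (u : G.V) (w : {w // G.E u w}) :
    J.path w.1 = insert (J.edgeLabel u w) (J.path u) := by
  ext p
  constructor
  · rintro ⟨z, y, hr, rfl⟩
    rcases (G.reflTransGen_child_iff w.2 y.1).1 hr with h | h
    · obtain rfl : z = u := G.parent_unique _ _ _ (h ▸ y.2) w.2
      obtain rfl : y = w := Subtype.ext h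
      exact Set.mem_insert _ _
    · exact Set.mem_insert_of_mem _ ⟨z, y, h, rfl⟩
  · rintro (rfl | ⟨z, y, hr, rfl⟩)
    · exact ⟨u, w, .refl, rfl⟩
    · exact ⟨z, y, hr.tail w.2, rfl⟩

theorem ancestors_child (u : G.V) (w : {w // G.E u w}) :
    J.ancestors w.1 = insert (J.edgeLabel u w).1 (J.ancestors u) := by
  rw [ancestors, path_child, Set.image_insert_eq, ancestors]

theorem mem_image_fst_iff {J : G.Grouping} (p : Set (Σ x : J.Var, J.val x)) (x : J.Var) :
    x ∈ Sigma.fst '' p ↔ ∃ t, ⟨x, t⟩ ∈ p := by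
  constructor
  · rintro ⟨⟨x, t⟩, h, rfl⟩
    exact ⟨t, h⟩
  · rintro ⟨t, h⟩
    exact ⟨_, h, rfl⟩

/-- The instantiation `a` has all the labels in `p`. -/
def Agrees (a : ∀ x : J.Var, J.dom x) (p : Set (Σ x : J.Var, J.val x)) : Prop :=
  ∀ q ∈ p, a q.1 = J.toDom q.1 q.2

theorem consistent_iff_agrees (a : ∀ x : J.Var, J.dom x) (R : J.Var → Prop)
    (p : Set (Σ x : J.Var, J.val x)) (hR : ∀ q ∈ p, R q.1) :
    J.Consistent R (fun y => a y.1) p ↔ J.Agrees a p :=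
  ⟨fun h q hq => (h q hq).choose_spec, fun h q hq => ⟨hR q hq, h q hq⟩⟩

end Grouping

/-! ### Information sets as decision contexts of the model -/

namespace InterventionSets

variable (J : G.InterventionSets)

theorem edgeLabel_notMem_ancestors (u : G.V) (w : {w // G.E u w}) :
    (J.edgeLabel u w).1 ∉ J.ancestors u := by
  rintro ⟨_, ⟨z, y, hr, rfl⟩, h⟩
  exact J.once z y u w hr h

/-- By `once`, a variable labels at most one edge of a path. -/
theorem path_functional (v : G.V) (x : J.Var) (s t : J.val x) (hs : ⟨x, s⟩ ∈ J.path v)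
    (ht : ⟨x, t⟩ ∈ J.path v) : s = t := by
  have hv := G.reachable v
  induction hv with
  | refl =>
    rw [J.path_root] at hs
    exact hs.elim
  | @tail u w _ hE ih =>
    have hnot := J.edgeLabel_notMem_ancestors u ⟨w, hE⟩
    rw [J.path_child u ⟨w, hE⟩] at hs ht
    rcases hs with hs | hs <;> rcases ht with ht | ht
    · exact eq_of_heq (Sigma.mk.inj_iff.1 (hs.trans ht.symm)).2
    · rw [← hs] at hnot
      exact (hnot ⟨_, ht, rfl⟩).elim
    · rw [← ht] at hnot
      exact (hnot ⟨_, hs, rfl⟩).elim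
    · exact ih hs ht

theorem exists_known (I : G.Info) (y : {y // J.Parent y (.inr (J.dvar I))}) :
    ∃ t : J.val y.1, ⟨y.1, t⟩ ∈ J.known I := by
  obtain ⟨y, I', hI', hy⟩ := y
  rw [J.same_knowledge I' I hI'] at hy
  obtain ⟨⟨x, t⟩, h, rfl⟩ := hy
  exact ⟨t, h⟩

/-- The decision context of an information set: the values that are known there. -/
def infoContext (I : G.Info) : ∀ y : {y // J.Parent y (.inr (J.dvar I))}, J.dom y.1 :=
  fun y => J.toDom y.1 (J.exists_known I y).choose

theorem infoContext_eq (I : G.Info) (y : {y // J.Parent y (.inr (J.dvar I))}) (t : J.val y.1)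
    (h : ⟨y.1, t⟩ ∈ J.known I) : J.infoContext I y = J.toDom y.1 t := by
  obtain ⟨v, hv⟩ := G.info_nonempty I
  exact congrArg _ (J.path_functional v _ _ _ ((J.exists_known I y).choose_spec v hv) (h v hv))

/-- The decision context determines what is known: both information sets know the values of the same
variables, and `toDom` is injective. With `separated`, this makes the embedding injective. -/
theorem known_subset (I I' : G.Info)
    (h : (⟨J.dvar I, J.infoContext I⟩ : Σ d, (efg2maim G J).Context (.inr d)) =
      ⟨J.dvar I', J.infoContext I'⟩) : J.known I ⊆ J.known I' := by
  have hd : J.dvar I = J.dvar I' := congrArg Sigma.fst h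
  have key : ∀ s s' : Σ d, (efg2maim G J).Context (.inr d), s = s' →
      ∀ x hx hx', s.2 ⟨x, hx⟩ = s'.2 ⟨x, hx'⟩ := by
    rintro s _ rfl x hx hx'
    rfl
  rintro ⟨x, t⟩ hx
  have hx' : x ∈ J.knownVars I' := by
    rw [← J.same_knowledge I I' hd]
    exact ⟨_, hx, rfl⟩
  obtain ⟨t', ht'⟩ := (Grouping.mem_image_fst_iff _ _).1 hx'
  have hp : J.Parent x (.inr (J.dvar I)) := ⟨I, rfl, _, hx, rfl⟩
  have hp' : J.Parent x (.inr (J.dvar I')) := ⟨I', rfl, _, ht', rfl⟩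
  have h1 : J.infoContext I ⟨x, hp⟩ = J.infoContext I' ⟨x, hp'⟩ := key _ _ h x hp hp'
  rw [J.infoContext_eq I _ t hx, J.infoContext_eq I' _ t' ht'] at h1
  obtain rfl := J.toDom_injective _ h1
  exact ht'

/-- Information sets are decision contexts of their variables. -/
def infoEmbedding : InfoEmbedding G (efg2maim G J) where
  dec := J.dvar
  ctx := J.infoContext
  act := J.dlabel
  inj := fun I I' h => J.separated I I' (congrArg Sigma.fst h)
    (Set.Subset.antisymm (J.known_subset I I' h) (J.known_subset I' I h.symm))
  owner_dec := J.owner_dvar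

/-- By `consistent_unique`, no chance node of the variable other than `u` contributes to the sum,
and at `u` only the edge `w` has the given label. -/
theorem labelProb_of_consistent (u : {u // G.kind u = .chance})
    (c : ∀ y : {y // J.Parent y (.inl (J.cvar u))}, J.dom y.1)
    (hc : J.Consistent _ c (J.path u.1)) (w : {w // G.E u.1 w}) :
    J.labelProb (J.cvar u) c (J.clabel u w) = (G.P u.2).1 w := by
  unfold Grouping.labelProb
  rw [Finset.sum_eq_single u, Finset.sum_eq_single w]
  · exact if_pos ⟨J.edgeLabel_chance u w, hc⟩
  · intro w' _ hw
    refine if_neg fun h => hw (J.edgeLabel_injective _ ?_)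
    rw [h.1, J.edgeLabel_chance]
  · simp
  · intro u' _ hu'
    refine Finset.sum_eq_zero fun w' _ => if_neg fun h => hu' ?_
    have h2 := h.1
    rw [J.edgeLabel_chance] at h2
    exact J.consistent_unique _ c u' u (Sum.inl_injective (Sigma.mk.inj_iff.1 h2).1) h.2 hc
  · simp

/-- Along a path with which an instantiation agrees, the factors of the joint distribution are the
probabilities of the edges. -/
theorem kernel_edgeLabel (π : (efg2maim G J).Policy) (a : (efg2maim G J).Assignment) (u : G.V)
    (w : {w // G.E u w}) (ha : J.Agrees a (J.path w.1)) :
    (efg2maim G J).kernel π (J.edgeLabel u w).1 a =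
      G.stepProb (J.infoEmbedding.restrict π) u w := by
  have hu : J.Agrees a (J.path u) := fun q hq => ha q <| by
    rw [J.path_child]
    exact Set.mem_insert_of_mem _ hq
  have hw : a (J.edgeLabel u w).1 = J.toDom _ (J.edgeLabel u w).2 := ha _ <| by
    rw [J.path_child]
    exact Set.mem_insert _ _
  rcases hk : G.kind u with _ | _ | I
  · exact ((G.leaf_iff u).1 hk w.1 w.2).elim
  · rw [G.stepProb_chance _ hk]
    rw [J.edgeLabel_chance ⟨u, hk⟩ w] at hw ⊢
    change J.cpdFun _ _ (a (.inl (J.cvar ⟨u, hk⟩))) = _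
    have hw' : a (.inl (J.cvar ⟨u, hk⟩)) = some (J.clabel ⟨u, hk⟩ w) := hw
    rw [hw']
    refine J.labelProb_of_consistent ⟨u, hk⟩ _ ?_ w
    refine (J.consistent_iff_agrees a _ _ fun q hq => ?_).2 hu
    exact ⟨⟨u, hk⟩, rfl, q, hq, rfl⟩
  · rw [G.stepProb_decision _ hk]
    rw [J.edgeLabel_decision hk w] at hw ⊢
    change (π (J.dvar I) ((efg2maim G J).parents a (.inr (J.dvar I)))).1 (a (.inr (J.dvar I))) =
      (π (J.dvar I) (J.infoContext I)).1 (J.dlabel I (G.label hk w))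
    -- The parents of the variable are known at `I`, and known labels lie on the path to every node
    -- of `I`, in particular on that to `u`, where `a` agrees with them.
    have hctx : (efg2maim G J).parents a (.inr (J.dvar I)) = J.infoContext I := by
      funext y
      obtain ⟨t, ht⟩ := J.exists_known I y
      rw [J.infoContext_eq I y t ht]
      exact hu _ (ht u hk)
    rw [hctx]
    exact congrArg _ hw

theorem prod_kernel_ancestors (π : (efg2maim G J).Policy) (a : (efg2maim G J).Assignment)
    (v : G.V) (ha : J.Agrees a (J.path v)) :
    ∏ x : J.Var with x ∈ J.ancestors v, (efg2maim G J).kernel π x a =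
      G.pathProb (J.infoEmbedding.restrict π) v := by
  have hv := G.reachable v
  induction hv with
  | refl => simp [Grouping.ancestors, J.path_root, G.pathProb_root]
  | @tail u w _ hE ih =>
    have hins : (Finset.univ.filter fun x : J.Var => x ∈ J.ancestors w) =
        insert (J.edgeLabel u ⟨w, hE⟩).1
          (Finset.univ.filter fun x : J.Var => x ∈ J.ancestors u) := by
      ext x
      simp [J.ancestors_child u ⟨w, hE⟩]
    rw [hins, Finset.prod_insert (by simpa using J.edgeLabel_notMem_ancestors u ⟨w, hE⟩),
      G.pathProb_child _ u ⟨w, hE⟩, J.kernel_edgeLabel π a u ⟨w, hE⟩ ha, mul_comm]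
    congr 1
    exact ih fun q hq => ha q <| by
      rw [J.path_child u ⟨w, hE⟩]
      exact Set.mem_insert_of_mem _ hq

/-! ### Reaching a node: tree probability and joint distribution -/

/-- The factors of the joint distribution, with those of the ancestors of `v` replaced by point
masses at the labels of the path to `v`. -/
def pathKernel (π : (efg2maim G J).Policy) (v : G.V) (x : (efg2maim G J).Node)
    (a : (efg2maim G J).Assignment) : ℝ :=
  if (x : J.Var) ∈ J.ancestors v then
    if ∃ t : J.val x, ⟨x, t⟩ ∈ J.path v ∧ a x = J.toDom x t then 1 else 0
  else (efg2maim G J).kernel π x a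

section

variable (π : (efg2maim G J).Policy) (v : G.V) (x : (efg2maim G J).Node)
  (a : (efg2maim G J).Assignment)

theorem pathKernel_of_mem (t : J.val x) (h : ⟨x, t⟩ ∈ J.path v) :
    J.pathKernel π v x a = if a x = J.toDom x t then 1 else 0 := by
  unfold pathKernel
  rw [if_pos ⟨_, h, rfl⟩]
  congr 1
  refine propext ⟨?_, fun h' => ⟨t, h, h'⟩⟩
  rintro ⟨t', ht', h'⟩
  rw [h', J.path_functional v x t' t ht' h]

theorem pathKernel_of_notMem (h : (x : J.Var) ∉ J.ancestors v) :
    J.pathKernel π v x a = (efg2maim G J).kernel π x a :=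
  if_neg h

theorem sum_pathKernel :
    ∑ t, J.pathKernel π v x (Function.update a x t) = 1 := by
  by_cases hx : (x : J.Var) ∈ J.ancestors v
  · obtain ⟨t, ht⟩ := (Grouping.mem_image_fst_iff _ _).1 hx
    simp only [J.pathKernel_of_mem π v x _ t ht, Function.update_self]
    exact Fintype.sum_ite_eq' _ _
  · simp only [J.pathKernel_of_notMem π v x _ hx]
    exact (efg2maim G J).sum_kernel π x a

theorem pathKernel_update (y : (efg2maim G J).Node) (hne : x ≠ y) (hE : ¬ (efg2maim G J).E y x)
    (t : (efg2maim G J).dom y) :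
    J.pathKernel π v x (Function.update a y t) = J.pathKernel π v x a := by
  by_cases hx : (x : J.Var) ∈ J.ancestors v
  · obtain ⟨s, hs⟩ := (Grouping.mem_image_fst_iff _ _).1 hx
    simp only [J.pathKernel_of_mem π v x _ s hs, Function.update_of_ne hne]
  · simp only [J.pathKernel_of_notMem π v x _ hx]
    exact (efg2maim G J).kernel_update π x y hne hE a t

end

/-- The probability that the joint distribution agrees with the path to a node is the probability
that play reaches this node. -/
theorem sum_prob_agrees (π : (efg2maim G J).Policy) (v : G.V) :
    ∑ a : (efg2maim G J).Assignment, (if J.Agrees a (J.path v) then (efg2maim G J).prob π a else 0)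
      = G.pathProb (J.infoEmbedding.restrict π) v := by
  -- Point masses keep the kernels normalized and add no dependence. The total `1` therefore says
  -- that the factors of the non-ancestors sum to one over the assignments that agree with the path.
  have hsum := sum_prod_kernel (efg2maim G J).acyclic (J.pathKernel π v)
    (J.sum_pathKernel π v) (fun x y hne hE a t => J.pathKernel_update π v x a y hne hE t)
  rw [← mul_one (G.pathProb _ v), ← hsum, Finset.mul_sum]
  refine Finset.sum_congr rfl fun a _ => ?_
  by_cases ha : J.Agrees a (J.path v)
  · rw [if_pos ha, ← MAIM.prod_kernel, ← J.prod_kernel_ancestors π a v ha, Finset.prod_filter]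
    refine Eq.trans ?_ Finset.prod_mul_distrib
    refine Finset.prod_congr rfl fun (x : J.Var) _ => ?_
    by_cases hx : x ∈ J.ancestors v
    · obtain ⟨t, ht⟩ := (Grouping.mem_image_fst_iff _ _).1 hx
      rw [if_pos hx, J.pathKernel_of_mem π v x a t ht]
      exact ((congrArg _ (if_pos (ha _ ht))).trans (mul_one _)).symm
    · rw [if_neg hx, J.pathKernel_of_notMem π v x a hx, one_mul]
  · rw [if_neg ha]
    have : ∃ p ∈ J.path v, a p.1 ≠ J.toDom p.1 p.2 := by
      by_contra h
      push Not at h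
      exact ha h
    obtain ⟨⟨x, t⟩, ht, hne⟩ := this
    -- A single violated label already gives a vanishing point mass.
    have h0 : J.pathKernel π v x a = 0 := by
      rw [J.pathKernel_of_mem π v x a t ht]
      exact if_neg hne
    exact (mul_eq_zero_of_right _ (Finset.prod_eq_zero (Finset.mem_univ x) h0)).symm

/-- Merging is harmless: each leaf is counted in exactly one utility node of `i`, the one whose
parents are the variables of its ancestors. -/
theorem sum_utilVal (a : (efg2maim G J).Assignment) (i : Fin n) :
    ∑ j : (efg2maim G J).U with (efg2maim G J).ownerU j = i, (efg2maim G J).utilVal j a =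
      ∑ L : {v // G.kind v = .leaf}, if J.Agrees a (J.path L.1) then G.U L i else 0 := by
  change ∑ j : (efg2maim G J).U with _, ∑ L : {v // G.kind v = .leaf},
    (if J.ancestors L.1 = j.2.1 ∧
      J.Consistent (fun y => y ∈ j.2.1) (fun y => a y.1) (J.path L.1) then G.U L j.1 else 0) = _
  rw [Finset.sum_comm]
  refine Finset.sum_congr rfl fun L _ => ?_
  let j₀ : (efg2maim G J).U := (i, ⟨J.ancestors L.1, L.1, L.2, rfl⟩)
  rw [Finset.sum_eq_single j₀]
  · have := J.consistent_iff_agrees a (fun y => y ∈ J.ancestors L.1) (J.path L.1)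
      fun q hq => ⟨q, hq, rfl⟩
    simp [j₀, this]
  · intro j hj hne
    refine if_neg fun h => hne ?_
    exact Prod.ext (Finset.mem_filter.1 hj).2 (Subtype.ext h.1.symm)
  · intro h
    exact (h (Finset.mem_filter.2 ⟨Finset.mem_univ _, rfl⟩)).elim

/-- By linearity, each payoff is weighted by the probability of agreeing with the path to its leaf,
which `sum_prob_agrees` identifies with the path probability. -/
theorem preservesUtility : J.infoEmbedding.PreservesUtility := by
  intro π i
  rw [MAIM.expectedUtility_eq, EFG.expectedUtility]
  simp only [J.sum_utilVal, Finset.mul_sum, ← J.sum_prob_agrees, Finset.sum_mul]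
  rw [Finset.sum_comm]
  refine Finset.sum_congr rfl fun a _ => Finset.sum_congr rfl fun L _ => ?_
  split_ifs <;> simp

end InterventionSets

end EFG

end
-- The proposition, for both constructions
theorem proposition2 {n : ℕ} (G : EFG n) (M : MAIM n)
    (h : G ∈ maim2efg M ∨ ∃ J : G.InterventionSets, M = efg2maim G J) :
    ∃ f : NaturalMapping G M,
      ∀ σ : G.Strategy, G.IsTHPE σ ↔ ∀ π ∈ f.image σ, M.IsTHPE π := by
  rcases h with ⟨T, rfl⟩ | ⟨J, rfl⟩
  · exact ⟨_, T.infoEmbedding.isTHPE_iff_image T.preservesUtility⟩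
  · exact ⟨_, J.infoEmbedding.isTHPE_iff_image J.preservesUtility⟩
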